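/- For all real numbers $A>0$, $Q>0$ and $m>\left(\frac{A}{16\pi}\right)^{1/2}$ there exist a connected smooth $3$-manifold $M$ (without boundary, Hausdorff, second countable), a smooth Riemannian metric $g$ on $M$ and a smooth vector field $E$ on $M$ with the following properties. 1. $(M,g,E)$ is a charged asymptotically flat manifold: there are a compact set $K\subset M$, a number $r_0>0$ and a diffeomorphism $x:M\setminus K\to\mathbb R^3\setminus\{|x|\le r_0\}$ such that for every $r>r_0$ the set $M\setminus\{|x|>r\}$ is compact, and, in the coordinates $x^i$, as $|x|\to\infty$, $$g_{ij}-\delta_{ij}=O(|x|^{-1}),\quad \partial g_{ij}=O(|x|^{-2}),\quad \partial^2g_{ij}=O(|x|^{-3}),\quad E^i=O(|x|^{-2}),\quad \partial E^i=O(|x|^{-3}).$$ 2. The charged dominant energy condition $R(g)\ge 2|E|_g^2$ holds at every point of $M$, where $R(g)$ is the scalar curvature. 3. The ADM mass is $m$: $\displaystyle\frac1{16\pi}\lim_{R\to\infty}\int_{S_R}\sum_{i,j}(\partial_ig_{ij}-\partial_jg_{ii})\,\frac{x^j}{|x|}\,dS=m$, where $S_R=\{|x|=R\}$ and $dS$ is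 Euclidean surface measure. 4. The total charge is $Q$: $\displaystyle\frac1{4\pi}\lim_{R\to\infty}\int_{S_R}\langle E,n\rangle_g\,dS_g=Q$, where $n$ is the outward $g$-unit normal and $dS_g$ the $g$-area element of $S_R$. 5. $M$ contains an outermost minimal surface $\Sigma$ of $g$-area $A$, homeomorphic to the $2$-sphere. Here a closed minimal surface is a compact smoothly embedded surface without boundary whose mean curvature vanishes; the exterior of $\Sigma$ is the part of $M\setminus\Sigma$ that is connected to infinity; and $\Sigma$ is outermost if it is a closed minimal surface, $\Sigma$ is the topological boundary of the closure of its exterior, and no closed minimal surface in $M$ meets the exterior of $\Sigma$. -/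

import Mathlib

open scoped Manifold ContDiff Topology
open MeasureTheory Filter

noncomputable section

namespace ChargedAF

/-- Euclidean `3`-space, the model of all the manifolds below. -/
abbrev E3 : Type := EuclideanSpace ℝ (Fin 3)

/-! ### Riemannian geometry in local coordinates

`G : E3 → Matrix (Fin 3) (Fin 3) ℝ` is the matrix `g_ij` of a metric in some coordinates. -/

/-- The partial derivative `∂_k f` at `x`. -/
def pderiv (k : Fin 3) (f : E3 → ℝ) (x : E3) : ℝ :=
  fderiv ℝ f x (EuclideanSpace.single k 1)

/-- The Christoffel symbol
`Γ^k_ij = 1/2 ∑_l g^kl (∂_i g_jl + ∂_j g_il - ∂_l g_ij)`. -/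
def christoffel (G : E3 → Matrix (Fin 3) (Fin 3) ℝ) (k i j : Fin 3) (x : E3) : ℝ :=
  (1 / 2) * ∑ l, (G x)⁻¹ k l *
    (pderiv i (fun y => G y j l) x + pderiv j (fun y => G y i l) x
      - pderiv l (fun y => G y i j) x)

/-- The Ricci curvature
`R_ij = ∂_k Γ^k_ij - ∂_j Γ^k_ik + Γ^k_kl Γ^l_ij - Γ^k_jl Γ^l_ik` (summed over `k`, `l`). -/
def ricci (G : E3 → Matrix (Fin 3) (Fin 3) ℝ) (i j : Fin 3) (x : E3) : ℝ :=
  (∑ k, (pderiv k (christoffel G k i j) x - pderiv j (christoffel G k i k) x)) +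
  ∑ k, ∑ l, (christoffel G k k l x * christoffel G l i j x
    - christoffel G k j l x * christoffel G l i k x)

/-- The scalar curvature `g^ij R_ij` (positive on round spheres). -/
def coordScalarCurvature (G : E3 → Matrix (Fin 3) (Fin 3) ℝ) (x : E3) : ℝ :=
  ∑ i, ∑ j, (G x)⁻¹ i j * ricci G i j x

/-- `|∇f|² = g^ij ∂_i f ∂_j f`. -/
def coordGradSq (G : E3 → Matrix (Fin 3) (Fin 3) ℝ) (f : E3 → ℝ) (x : E3) : ℝ :=
  ∑ i, ∑ j, (G x)⁻¹ i j * pderiv i f x * pderiv j f x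

/-- The component `n^i = g^ij ∂_j f / |∇f|` of the unit normal `∇f / |∇f|` of a level set of `f`. -/
def coordNormal (G : E3 → Matrix (Fin 3) (Fin 3) ℝ) (f : E3 → ℝ) (i : Fin 3) (x : E3) : ℝ :=
  (∑ j, (G x)⁻¹ i j * pderiv j f x) / Real.sqrt (coordGradSq G f x)

/-- The component `∂_i ∂_j f - Γ^k_ij ∂_k f` of the covariant Hessian of `f`. -/
def coordHessian (G : E3 → Matrix (Fin 3) (Fin 3) ℝ) (f : E3 → ℝ) (i j : Fin 3) (x : E3) : ℝ :=
  pderiv i (pderiv j f) x - ∑ k, christoffel G k i j x * pderiv k f x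

/-- The mean curvature, with respect to the unit normal `n = ∇f / |∇f|`, of the level set of `f`
through `x`: the second fundamental form is `Hess f / |∇f|` on the tangent plane `ker df`, and
`g^ij - n^i n^j` is the inverse of the induced metric, so
`H = div (∇f / |∇f|) = (g^ij - n^i n^j) (Hess f)_ij / |∇f|`. -/
def coordMeanCurvature (G : E3 → Matrix (Fin 3) (Fin 3) ℝ) (f : E3 → ℝ) (x : E3) : ℝ :=
  (∑ i, ∑ j, ((G x)⁻¹ i j - coordNormal G f i x * coordNormal G f j x) * coordHessian G f i j x)
    / Real.sqrt (coordGradSq G f x)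

/-! ### Riemannian `3`-manifolds -/

section Manifold

variable {M : Type} [TopologicalSpace M] [ChartedSpace E3 M] [IsManifold (𝓡 3) ∞ M]

/-- The type of smooth Riemannian metrics on `M`. -/
abbrev Metric (M : Type) [TopologicalSpace M] [ChartedSpace E3 M] [IsManifold (𝓡 3) ∞ M] : Type :=
  Bundle.ContMDiffRiemannianMetric (𝓡 3) ∞ E3 (fun p : M => TangentSpace (𝓡 3) p)

/-- The type of smooth vector fields on `M`. -/
abbrev VField (M : Type) [TopologicalSpace M] [ChartedSpace E3 M] [IsManifold (𝓡 3) ∞ M] : Type :=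
  ContMDiffSection (𝓡 3) E3 ∞ (fun p : M => TangentSpace (𝓡 3) p)

/-- The Gram matrix `g(∂_i X, ∂_j X)` of a map `X` from `ℝⁿ` to `M`. If `X` is the inverse of a
chart (`n = 3`), it is the matrix of `g` in that chart; if `X` is a parametrization of a surface
(`n = 2`), it is the first fundamental form of the surface. -/
def gram {n : ℕ} (g : Metric M) (X : EuclideanSpace ℝ (Fin n) → M)
    (x : EuclideanSpace ℝ (Fin n)) : Matrix (Fin n) (Fin n) ℝ :=
  Matrix.of fun i j =>
    g.inner (X x)
      (mfderiv (𝓡 n) (𝓡 3) X x (EuclideanSpace.single i (1 : ℝ) : EuclideanSpace ℝ (Fin n)))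
      (mfderiv (𝓡 n) (𝓡 3) X x (EuclideanSpace.single j (1 : ℝ) : EuclideanSpace ℝ (Fin n)))

/-- The scalar curvature of `g` at `p` (computed in the preferred chart at `p`). -/
def scalarCurvature (g : Metric M) (p : M) : ℝ :=
  coordScalarCurvature (gram g (chartAt E3 p).symm) (chartAt E3 p p)

/-- The charged dominant energy condition `R(g) ≥ 2 |E|²`. -/
def ChargedDEC (g : Metric M) (E : VField M) : Prop :=
  ∀ p : M, 2 * g.inner p (E p) (E p) ≤ scalarCurvature g p

/-! ### Surfaces -/

/-- `f` is a smooth defining function of `S` near the point `p` of `S`. -/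
def IsLocalDefiningFunction (S : Set M) (p : M) (f : M → ℝ) : Prop :=
  mfderiv (𝓡 3) 𝓘(ℝ, ℝ) f p ≠ 0 ∧
  ∃ U : Set M, IsOpen U ∧ p ∈ U ∧ ContMDiffOn (𝓡 3) 𝓘(ℝ, ℝ) ∞ f U ∧ ∀ q ∈ U, q ∈ S ↔ f q = 0

/-- The mean curvature at `p` of the level set of `f` through `p`. -/
def meanCurvature (g : Metric M) (f : M → ℝ) (p : M) : ℝ :=
  coordMeanCurvature (gram g (chartAt E3 p).symm) (f ∘ (chartAt E3 p).symm) (chartAt E3 p p)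

/-- `S` is a closed minimal surface: compact, without boundary, smoothly embedded, and with
vanishing mean curvature. (Two local defining functions at `p` give the same mean curvature up to
sign, so it does not matter which one is used.) The surface need not be connected. -/
def IsClosedMinimalSurface (g : Metric M) (S : Set M) : Prop :=
  IsCompact S ∧
  ∀ p ∈ S, ∃ f : M → ℝ, IsLocalDefiningFunction S p f ∧ meanCurvature g f p = 0

/-- The surface `S` has area `A` with respect to `g`: `S` is the disjoint union of finitely many
Borel pieces `X k '' B k` of images of smooth regular injective parametrizations
`X k : U k → S`, and `A` is the sum of the integrals of the area element
`√(det (first fundamental form))` over the `B k`. (The sum does not depend on the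
decomposition.) -/
def HasArea (g : Metric M) (S : Set M) (A : ℝ) : Prop :=
  ∃ (n : ℕ) (X : Fin n → EuclideanSpace ℝ (Fin 2) → M)
    (U B : Fin n → Set (EuclideanSpace ℝ (Fin 2))),
    (∀ k, IsOpen (U k) ∧ MeasurableSet (B k) ∧ B k ⊆ U k ∧
      Set.InjOn (X k) (U k) ∧ Set.MapsTo (X k) (U k) S ∧
      ContMDiffOn (𝓡 2) (𝓡 3) ∞ (X k) (U k) ∧
      (∀ y ∈ U k, Function.Injective (mfderiv (𝓡 2) (𝓡 3) (X k) y)) ∧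
      IntegrableOn (fun y => Real.sqrt (gram g (X k) y).det) (B k)) ∧
    (⋃ k, X k '' B k) = S ∧
    (∀ k l, k ≠ l → Disjoint (X k '' B k) (X l '' B l)) ∧
    (∑ k, ∫ y in B k, Real.sqrt (gram g (X k) y).det) = A

/-! ### The asymptotically flat end -/

/-- Cartesian coordinates near infinity: a diffeomorphism from the complement of a compact set
`K = chart.sourceᶜ` of `M` onto the complement of a closed ball in `ℝ³`. The last condition says
that the coordinate spheres bound compact regions of `M`, that is, `|x| → ∞` is the only way of
leaving every compact set of `M`. -/
structure End (M : Type) [TopologicalSpace M] [ChartedSpace E3 M] where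
  chart : OpenPartialHomeomorph M E3
  chart_mem : chart ∈ IsManifold.maximalAtlas (𝓡 3) ∞ M
  radius : ℝ
  radius_pos : 0 < radius
  target_eq : chart.target = (Metric.closedBall (0 : E3) radius)ᶜ
  isCompact_compl : IsCompact chart.sourceᶜ
  isCompact_inside : ∀ r > radius, IsCompact (chart.symm '' {x : E3 | r < ‖x‖})ᶜ

/-- The matrix `g_ij` of `g` in the coordinates of the end. -/
def End.metric (e : End M) (g : Metric M) : E3 → Matrix (Fin 3) (Fin 3) ℝ :=
  gram g e.chart.symm

/-- The components `E^i` of the vector field `E` in the coordinates of the end. -/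
def End.field (e : End M) (E : VField M) (i : Fin 3) (x : E3) : ℝ :=
  let v : E3 := mfderiv (𝓡 3) (𝓡 3) e.chart (e.chart.symm x) (E (e.chart.symm x))
  v i

/-- `g - δ = O(|x|⁻¹)`, `∂g = O(|x|⁻²)`, `∂²g = O(|x|⁻³)` as `|x| → ∞`. -/
def IsAsymptoticallyFlat (g : Metric M) (e : End M) : Prop :=
  ∀ i j : Fin 3,
    ((fun x : E3 => e.metric g x i j - (1 : Matrix (Fin 3) (Fin 3) ℝ) i j)
      =O[Bornology.cobounded E3] fun x => ‖x‖ ^ (-1 : ℤ)) ∧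
    (∀ k, pderiv k (fun x => e.metric g x i j)
      =O[Bornology.cobounded E3] fun x => ‖x‖ ^ (-2 : ℤ)) ∧
    (∀ k l, pderiv k (pderiv l fun x => e.metric g x i j)
      =O[Bornology.cobounded E3] fun x => ‖x‖ ^ (-3 : ℤ))

/-- `E = O(|x|⁻²)` and `∂E = O(|x|⁻³)` as `|x| → ∞`. -/
def FieldDecays (E : VField M) (e : End M) : Prop :=
  ∀ i : Fin 3,
    (e.field E i =O[Bornology.cobounded E3] fun x => ‖x‖ ^ (-2 : ℤ)) ∧
    (∀ k, pderiv k (e.field E i) =O[Bornology.cobounded E3] fun x => ‖x‖ ^ (-3 : ℤ))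

/-- `(M, g, E)` is a charged asymptotically flat manifold with Cartesian coordinates `e` near
infinity. -/
def IsChargedAF (g : Metric M) (E : VField M) (e : End M) : Prop :=
  IsAsymptoticallyFlat g e ∧ FieldDecays E e

/-- The integral of `F` over the coordinate sphere `S_R` of radius `R` about the origin with
respect to Euclidean surface measure; `volume.toSphere` is the surface measure of the unit sphere,
of total mass `4π`. -/
def sphereIntegral (F : E3 → ℝ) (R : ℝ) : ℝ :=
  R ^ 2 * ∫ u : Metric.sphere (0 : E3) 1, F (R • (u : E3)) ∂(volume : Measure E3).toSphere

/-- The ADM mass is `m`: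
`m = (1 / 16π) lim_{R → ∞} ∫_{S_R} (∂_i g_ij - ∂_j g_ii) ν^j dS`, with `ν = x / |x|`. -/
def HasADMMass (g : Metric M) (e : End M) (m : ℝ) : Prop :=
  Tendsto (fun R : ℝ => 1 / (16 * Real.pi) * sphereIntegral (fun x => ∑ i, ∑ j,
      (pderiv i (fun y => e.metric g y i j) x - pderiv j (fun y => e.metric g y i i) x)
        * (x j / ‖x‖)) R)
    atTop (𝓝 m)

/-- The total charge is `Q`: `Q = (1 / 4π) lim_{R → ∞} ∫_{S_R} E · n dS`. Here `n` and `dS` are the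
unit normal and the area element of the metric `g`; since
`n^i = g^ij ν_j / √(g^kl ν_k ν_l)` and `dS = √(det g) √(g^kl ν_k ν_l) dS_Eucl`
with `ν = x / |x|`, one has `E · n dS = √(det g) E^i ν_i dS_Eucl`. -/
def HasTotalCharge (g : Metric M) (E : VField M) (e : End M) (Q : ℝ) : Prop :=
  Tendsto (fun R : ℝ => 1 / (4 * Real.pi) * sphereIntegral (fun x =>
      Real.sqrt (e.metric g x).det * ∑ i, e.field E i x * (x i / ‖x‖)) R)
    atTop (𝓝 Q)

/-- The exterior of `S`: the part of `M` that is connected to infinity in the complement of `S`. -/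
def End.exterior (e : End M) (S : Set M) : Set M :=
  {p | ∃ C : Set M, IsConnected C ∧ C ⊆ Sᶜ ∧ p ∈ C ∧
    ∃ R ≥ e.radius, e.chart.symm '' {x : E3 | R < ‖x‖} ⊆ C}

/-- `S` is the outermost minimal surface of `M`: it is a closed minimal surface, it is the boundary
of the closure of its exterior (so it separates the exterior from the rest of `M`, and no part of it
is hidden behind another), and no closed minimal surface of `M` enters its exterior. -/
def IsOutermostMinimalSurface (g : Metric M) (e : End M) (S : Set M) : Prop :=
  IsClosedMinimalSurface g S ∧
  frontier (closure (e.exterior S)) = S ∧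
  ∀ S' : Set M, IsClosedMinimalSurface g S' → Disjoint S' (e.exterior S)

end Manifold

end ChargedAF

end

noncomputable section

namespace ChargedAF

/-! ### Calculus of partial derivatives -/

/-! The manifold is ℝ³ with a rotationally symmetric metric u⁴δ. Its scalar curvature is -8u⁻⁵Δu
(`coordScalarCurvature_conf`), so positivity of curvature is superharmonicity of u. Nothing requires
E to be divergence free: the charge can be spread far outside the horizon, which is why only the
uncharged Penrose inequality restricts m.

Take u = 1 + a/√(r²+e) + b/√(r²+L) - c/(r²+L). The a-source, smoothed at scale √e, produces a nearly
Schwarzschild horizon. The b-source, smoothed at the large scale l = √L, supplies the rest of the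
mass, which is 2(a+b). The c-term gives Δu ≤ -2c(r²+L)⁻² (`laplacian_factor_le`); it alone decays as
slowly as the energy r⁻⁴ of a charged field. For E = Q u⁻⁵(r²+L)^(-3/2) x the energy condition
therefore reduces to Q² ≤ 8c (`chargedDEC`). The decisive point is that c = bl/3 is admissible and
tends to infinity with l, while the influence of the far source on the unit sphere is O(b/l).

The sphere of radius r has mean curvature of the sign of u + 2r ∂u/∂r, which is `sphereCurv`. At
unit scale, a is fixed by minimality of the unit sphere. Then b is found by the intermediate value
theorem so that mass and area have the right ratio (`exists_unit_profile`), and a dilation fixes the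
mass (`exists_profile`). When l is large, all larger spheres are strictly mean convex
(`sphereCurv_pos`).

Outermostness is the maximum principle. A closed minimal surface entering the exterior has a point
farthest from the origin. There it touches a mean convex sphere from inside, so its mean curvature
is at least that of the sphere, hence nonzero (`touching_conditions`, `meanCurvature_ne_zero`). -/

lemma pderiv_const (k : Fin 3) (c : ℝ) (x : E3) : pderiv k (fun _ => c) x = 0 := by
  simp [pderiv]

lemma pderiv_add {k : Fin 3} {f h : E3 → ℝ} {x : E3} (hf : DifferentiableAt ℝ f x)
    (hh : DifferentiableAt ℝ h x) :
    pderiv k (fun y => f y + h y) x = pderiv k f x + pderiv k h x := by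
  simp [pderiv, fderiv_fun_add hf hh]

lemma pderiv_sub {k : Fin 3} {f h : E3 → ℝ} {x : E3} (hf : DifferentiableAt ℝ f x)
    (hh : DifferentiableAt ℝ h x) :
    pderiv k (fun y => f y - h y) x = pderiv k f x - pderiv k h x := by
  simp [pderiv, fderiv_fun_sub hf hh]

lemma pderiv_mul {k : Fin 3} {f h : E3 → ℝ} {x : E3} (hf : DifferentiableAt ℝ f x)
    (hh : DifferentiableAt ℝ h x) :
    pderiv k (fun y => f y * h y) x = pderiv k f x * h x + f x * pderiv k h x := by
  simp [pderiv, fderiv_fun_mul hf hh]; ring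

lemma pderiv_const_mul {k : Fin 3} {f : E3 → ℝ} {x : E3} (c : ℝ) (hf : DifferentiableAt ℝ f x) :
    pderiv k (fun y => c * f y) x = c * pderiv k f x := by
  rw [pderiv_mul (differentiableAt_const c) hf, pderiv_const]; ring

lemma pderiv_pow {k : Fin 3} {f : E3 → ℝ} {x : E3} (n : ℕ) (hf : DifferentiableAt ℝ f x) :
    pderiv k (fun y => f y ^ n) x = n * f x ^ (n - 1) * pderiv k f x := by
  simp [pderiv, fderiv_fun_pow n hf]

lemma pderiv_div {k : Fin 3} {f h : E3 → ℝ} {x : E3} (hf : DifferentiableAt ℝ f x)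
    (hh : DifferentiableAt ℝ h x) (h0 : h x ≠ 0) :
    pderiv k (fun y => f y / h y) x
      = (pderiv k f x * h x - f x * pderiv k h x) / h x ^ 2 := by
  have h1 : HasFDerivAt (fun y => (h y)⁻¹) ((-(h x ^ 2)⁻¹) • fderiv ℝ h x) x :=
    (hasDerivAt_inv h0).comp_hasFDerivAt x hh.hasFDerivAt
  have h2 := (hf.hasFDerivAt.mul h1).fderiv
  simp only [div_eq_mul_inv, pderiv]
  erw [h2]
  simp only [add_apply, smul_apply, smul_eq_mul]
  field_simp
  ring

lemma pderiv_coord (k i : Fin 3) (x : E3) :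
    pderiv k (fun y : E3 => y i) x = if i = k then 1 else 0 := by
  have : (fun y : E3 => y i) = (EuclideanSpace.proj i : E3 →L[ℝ] ℝ) := rfl
  rw [pderiv, this, ContinuousLinearMap.fderiv]
  simp

lemma pderiv_normSq (k : Fin 3) (x : E3) : pderiv k (fun y : E3 => ‖y‖ ^ 2) x = 2 * x k := by
  rw [pderiv, fderiv_norm_sq_apply]
  simp [EuclideanSpace.inner_single_right]

lemma normSq_eq (x : E3) : ‖x‖ ^ 2 = x 0 ^ 2 + x 1 ^ 2 + x 2 ^ 2 := by
  rw [EuclideanSpace.norm_sq_eq, Fin.sum_univ_three]; simp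

lemma contDiff_pderiv {f : E3 → ℝ} (hf : ContDiff ℝ ∞ f) (k : Fin 3) :
    ContDiff ℝ ∞ (pderiv k f) :=
  (hf.fderiv_right (m := ∞) (by simp)).clm_apply contDiff_const

/-! ### Conformally flat metrics -/

/-- The metric `u⁴ δ`. -/
def conf (u : E3 → ℝ) (x : E3) : Matrix (Fin 3) (Fin 3) ℝ := u x ^ 4 • 1

lemma conf_apply (u : E3 → ℝ) (x : E3) (i j : Fin 3) :
    conf u x i j = if i = j then u x ^ 4 else 0 := by
  simp [conf, Matrix.one_apply]

lemma conf_inv {u : E3 → ℝ} {x : E3} (hu : u x ≠ 0) (i j : Fin 3) :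
    (conf u x)⁻¹ i j = if i = j then (u x ^ 4)⁻¹ else 0 := by
  have h4 : u x ^ 4 ≠ 0 := pow_ne_zero 4 hu
  have : (conf u x)⁻¹ = (u x ^ 4)⁻¹ • 1 := by
    apply Matrix.inv_eq_right_inv
    simp [conf, h4]
  simp [this, Matrix.one_apply]

/-- The logarithmic gradient `∂_i u⁴ / (2 u⁴)` of the conformal factor. -/
def logGrad (u : E3 → ℝ) (i : Fin 3) (x : E3) : ℝ := 2 * pderiv i u x / u x

lemma pderiv_conf {u : E3 → ℝ} (hu : ContDiff ℝ ∞ u) (l i j : Fin 3) (x : E3) :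
    pderiv l (fun y => conf u y i j) x = if i = j then 4 * u x ^ 3 * pderiv l u x else 0 := by
  simp only [conf_apply]
  split_ifs with h
  · rw [pderiv_pow 4 (hu.differentiable (by simp) x)]; norm_num
  · exact pderiv_const _ _ _

/-- Conformal change from the flat metric: u⁴ = exp(2φ) and `logGrad u` is dφ. In terms of dφ the
curvature needs only first derivatives of these symbols, with constant coefficients. -/
lemma christoffel_conf {u : E3 → ℝ} (hu : ContDiff ℝ ∞ u) (h0 : ∀ x, u x ≠ 0) (k i j : Fin 3) :
    christoffel (conf u) k i j = fun x =>
      (if j = k then logGrad u i x else 0) + (if i = k then logGrad u j x else 0)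
        - (if i = j then logGrad u k x else 0) := by
  funext x
  have := h0 x
  simp only [christoffel, conf_inv (h0 x), pderiv_conf hu, ite_mul, zero_mul,
    Finset.sum_ite_eq, Finset.mem_univ, if_true, logGrad]
  split_ifs <;> field_simp <;> ring

lemma contDiff_logGrad {u : E3 → ℝ} (hu : ContDiff ℝ ∞ u) (h0 : ∀ x, u x ≠ 0) (i : Fin 3) :
    ContDiff ℝ ∞ (logGrad u i) :=
  (contDiff_const.mul (contDiff_pderiv hu i)).div hu h0

lemma pderiv_ite {f : E3 → ℝ} (p : Prop) [Decidable p] (l : Fin 3) (x : E3) :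
    pderiv l (fun y => if p then f y else 0) x = if p then pderiv l f x else 0 := by
  split_ifs
  · rfl
  · exact pderiv_const _ _ _

lemma differentiable_ite {f : E3 → ℝ} (hf : Differentiable ℝ f) (p : Prop) [Decidable p] :
    Differentiable ℝ (fun y => if p then f y else 0) := by
  split_ifs
  · exact hf
  · exact differentiable_const _

lemma pderiv_christoffel_conf {u : E3 → ℝ} (hu : ContDiff ℝ ∞ u) (h0 : ∀ x, u x ≠ 0)
    (l k i j : Fin 3) (x : E3) :
    pderiv l (christoffel (conf u) k i j) x =
      (if j = k then pderiv l (logGrad u i) x else 0)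
        + (if i = k then pderiv l (logGrad u j) x else 0)
        - (if i = j then pderiv l (logGrad u k) x else 0) := by
  have hd (i : Fin 3) : Differentiable ℝ (logGrad u i) :=
    (contDiff_logGrad hu h0 i).differentiable (by simp)
  rw [christoffel_conf hu h0]
  rw [pderiv_sub ((differentiable_ite (hd _) _ _).fun_add (differentiable_ite (hd _) _ _))
    (differentiable_ite (hd _) _ _),
    pderiv_add (differentiable_ite (hd _) _ _) (differentiable_ite (hd _) _ _),
    pderiv_ite, pderiv_ite, pderiv_ite]

lemma pderiv_logGrad {u : E3 → ℝ} (hu : ContDiff ℝ ∞ u) (h0 : ∀ x, u x ≠ 0) (l i : Fin 3)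
    (x : E3) : pderiv l (logGrad u i) x =
      2 * pderiv l (pderiv i u) x / u x - 2 * pderiv i u x * pderiv l u x / u x ^ 2 := by
  have hd := (contDiff_pderiv hu i).differentiable (by simp) x
  have := h0 x
  unfold logGrad
  rw [pderiv_div (hd.const_mul 2) (hu.differentiable (by simp) x) (h0 x), pderiv_const_mul _ hd]
  field_simp

/-- The scalar curvature of `u⁴ δ` is `-8 u⁻⁵ Δu`. -/
theorem coordScalarCurvature_conf {u : E3 → ℝ} (hu : ContDiff ℝ ∞ u) (h0 : ∀ x, u x ≠ 0)
    (x : E3) :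
    coordScalarCurvature (conf u) x = -8 * (∑ i, pderiv i (pderiv i u) x) / u x ^ 5 := by
  have := h0 x
  have h4 : coordScalarCurvature (conf u) x = (u x ^ 4)⁻¹ * ∑ i, ricci (conf u) i i x := by
    simp [coordScalarCurvature, conf_inv (h0 x), ite_mul, Finset.mul_sum]
  -- With w = d(2 log u), the Euclidean trace of the Ricci tensor is -4 div w - 2|w|². The quadratic
  -- terms cancel once w is expanded in u.
  have h5 : ∑ i, ricci (conf u) i i x
      = -4 * (∑ i, pderiv i (logGrad u i) x) - 2 * ∑ i, logGrad u i x ^ 2 := by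
    simp only [ricci, pderiv_christoffel_conf hu h0]
    simp only [christoffel_conf hu h0]
    simp [Fin.sum_univ_three]
    ring
  rw [h4, h5]
  simp only [Fin.sum_univ_three, pderiv_logGrad hu h0, logGrad]
  field_simp
  ring

/-- The sign of the mean curvature in `u⁴ δ` is determined by its Euclidean part and the normal
derivative of `u`. -/
theorem coordMeanCurvature_conf {u : E3 → ℝ} (hu : ContDiff ℝ ∞ u) (h0 : ∀ x, u x ≠ 0)
    (f : E3 → ℝ) (x : E3) (hf : ∑ i, pderiv i f x ^ 2 ≠ 0) :
    coordMeanCurvature (conf u) f x =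
      ((∑ i, pderiv i (pderiv i f) x)
        - (∑ i, ∑ j, pderiv i f x * pderiv j f x * pderiv i (pderiv j f) x)
            / (∑ i, pderiv i f x ^ 2)
        + 4 * (∑ i, pderiv i u x * pderiv i f x) / u x)
      / (u x ^ 4 * Real.sqrt (coordGradSq (conf u) f x)) := by
  have := h0 x
  have hg : coordGradSq (conf u) f x = (u x ^ 4)⁻¹ * ∑ i, pderiv i f x ^ 2 := by
    simp [coordGradSq, conf_inv (h0 x), ite_mul, Finset.mul_sum]
    simp only [sq, mul_assoc]
  have hpos : 0 < coordGradSq (conf u) f x := by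
    have h1 : 0 < ∑ i, pderiv i f x ^ 2 :=
      lt_of_le_of_ne (Finset.sum_nonneg fun i _ => sq_nonneg _) hf.symm
    have h2 : 0 < u x ^ 4 := by positivity
    rw [hg]; positivity
  have hs : Real.sqrt (coordGradSq (conf u) f x) ^ 2 = (u x ^ 4)⁻¹ * ∑ i, pderiv i f x ^ 2 := by
    rw [Real.sq_sqrt hpos.le, hg]
  have hs0 : Real.sqrt (coordGradSq (conf u) f x) ≠ 0 := (Real.sqrt_pos.2 hpos).ne'
  have hn (i : Fin 3) : coordNormal (conf u) f i x
      = (u x ^ 4)⁻¹ * pderiv i f x / Real.sqrt (coordGradSq (conf u) f x) := by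
    simp [coordNormal, conf_inv (h0 x), ite_mul]
  have hnn (i j : Fin 3) : coordNormal (conf u) f i x * coordNormal (conf u) f j x
      = (u x ^ 4)⁻¹ * (pderiv i f x * pderiv j f x) / ∑ i, pderiv i f x ^ 2 := by
    rw [hn, hn, div_mul_div_comm, ← sq, hs]
    field_simp
  rw [coordMeanCurvature, div_mul_eq_div_div]
  congr 1
  simp only [hnn, conf_inv (h0 x), coordHessian, christoffel_conf hu h0]
  simp only [Fin.sum_univ_three, logGrad] at hf ⊢
  simp
  field_simp
  ring

/-! ### Radial superharmonic conformal factors -/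

/-- The softened inverse radius `(t + κ)^(-1/2)`, as a function of the squared radius `t`. -/
def softInv (κ t : ℝ) : ℝ := (Real.sqrt (t + κ))⁻¹

lemma softInv_pos {κ t : ℝ} (hκ : 0 < κ) (ht : 0 ≤ t) : 0 < softInv κ t :=
  inv_pos.2 (Real.sqrt_pos.2 (by linarith))

lemma softInv_sq {κ t : ℝ} (hκ : 0 < κ) (ht : 0 ≤ t) : softInv κ t ^ 2 * (t + κ) = 1 := by
  have : 0 < t + κ := by linarith
  rw [softInv, inv_pow, Real.sq_sqrt this.le, inv_mul_cancel₀ this.ne']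

lemma softInv_mul_sqrt_le {κ t : ℝ} (hκ : 0 < κ) (ht : 0 ≤ t) : softInv κ t * √κ ≤ 1 := by
  rw [softInv, inv_mul_le_one₀ (Real.sqrt_pos.2 (by linarith))]
  exact Real.sqrt_le_sqrt (by linarith)

lemma contDiff_softInv {κ : ℝ} (hκ : 0 < κ) :
    ContDiff ℝ ∞ (fun x : E3 => softInv κ (‖x‖ ^ 2)) := by
  have h (x : E3) : ‖x‖ ^ 2 + κ ≠ 0 := by positivity
  exact (((contDiff_norm_sq ℝ).add contDiff_const).sqrt h).inv
    fun x => (Real.sqrt_pos.2 (by positivity)).ne'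

lemma hasDerivAt_softInv {κ t : ℝ} (h : 0 < t + κ) :
    HasDerivAt (softInv κ) (-(softInv κ t ^ 3 / 2)) t := by
  have h1 : HasDerivAt (fun t => √(t + κ)) (1 / (2 * √(t + κ))) t :=
    ((hasDerivAt_id t).add_const κ).sqrt h.ne'
  have hs : √(t + κ) ≠ 0 := (Real.sqrt_pos.2 h).ne'
  refine (h1.inv hs).congr_deriv ?_
  simp only [softInv]
  field_simp

lemma pderiv_softInv {κ : ℝ} (hκ : 0 < κ) (i : Fin 3) (x : E3) :
    pderiv i (fun x : E3 => softInv κ (‖x‖ ^ 2)) x = -(x i * softInv κ (‖x‖ ^ 2) ^ 3) := by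
  have hd : DifferentiableAt ℝ (fun y : E3 => ‖y‖ ^ 2) x :=
    ((contDiff_norm_sq ℝ (n := ∞)).differentiable (by simp)) x
  have h1 := ((hasDerivAt_softInv (κ := κ) (t := ‖x‖ ^ 2) (by positivity)).comp_hasFDerivAt x
    hd.hasFDerivAt).fderiv
  have h2 := pderiv_normSq i x
  unfold pderiv at h2 ⊢
  simp only [Function.comp_def] at h1
  rw [h1, smul_apply, h2, smul_eq_mul]
  ring

/-- The parameters of a conformal factor `1 + a/√(r²+e) + b/√(r²+L) - c/(r²+L)`. -/
structure Profile where
  a : ℝ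
  b : ℝ
  c : ℝ
  e : ℝ
  L : ℝ
  a_nonneg : 0 ≤ a
  c_nonneg : 0 ≤ c
  e_pos : 0 < e
  L_pos : 0 < L
  -- Since (r²+L)^(-1/2) ≤ 1/√L, this keeps 3b - 8c(r²+L)^(-1/2) nonnegative, the one term of the
  -- Laplacian whose sign is not automatic. It also yields u ≥ 1.
  le_b : 8 * c ≤ 3 * b * √L

namespace Profile

variable (P : Profile)

/-- The conformal factor as a function of the squared radius. -/
def val (t : ℝ) : ℝ :=
  1 + P.a * softInv P.e t + P.b * softInv P.L t - P.c * softInv P.L t ^ 2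

/-- The derivative of the conformal factor with respect to the squared radius, times `-2`. -/
def slope (t : ℝ) : ℝ :=
  P.a * softInv P.e t ^ 3 + P.b * softInv P.L t ^ 3 - 2 * P.c * softInv P.L t ^ 4

/-- The derivative of the slope with respect to the squared radius, times `-2`. -/
def bend (t : ℝ) : ℝ :=
  3 * P.a * softInv P.e t ^ 5 + 3 * P.b * softInv P.L t ^ 5 - 8 * P.c * softInv P.L t ^ 6

/-- The conformal factor on `ℝ³`. -/
def factor (x : E3) : ℝ := P.val (‖x‖ ^ 2)

lemma b_nonneg : 0 ≤ P.b := by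
  have h := Real.sqrt_pos.2 P.L_pos
  have h1 := P.le_b
  have h2 := P.c_nonneg
  by_contra! hb
  nlinarith

lemma c_softInv_le {t : ℝ} (ht : 0 ≤ t) : 8 * P.c * softInv P.L t ≤ 3 * P.b := by
  have h1 := softInv_pos P.L_pos ht
  calc 8 * P.c * softInv P.L t ≤ 3 * P.b * √P.L * softInv P.L t := 
        mul_le_mul_of_nonneg_right P.le_b h1.le
    _ = 3 * P.b * (softInv P.L t * √P.L) := by ring
    _ ≤ 3 * P.b * 1 := by
        have := P.b_nonneg
        gcongr; exact softInv_mul_sqrt_le P.L_pos ht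
    _ = 3 * P.b := by ring

lemma one_le_val {t : ℝ} (ht : 0 ≤ t) : 1 ≤ P.val t := by
  have h1 := softInv_pos P.L_pos ht
  have h2 := mul_nonneg P.a_nonneg (softInv_pos P.e_pos ht).le
  have h3 := P.c_softInv_le ht
  have h4 := mul_nonneg P.c_nonneg h1.le
  have h5 : P.c * softInv P.L t ^ 2 ≤ P.b * softInv P.L t := by
    rw [sq, ← mul_assoc]; gcongr; linarith
  unfold val; linarith

lemma one_le_factor (x : E3) : 1 ≤ P.factor x := P.one_le_val (by positivity)

lemma factor_pos (x : E3) : 0 < P.factor x := one_pos.trans_le (P.one_le_factor x)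

lemma factor_ne_zero (x : E3) : P.factor x ≠ 0 := (P.factor_pos x).ne'

lemma contDiff_factor : ContDiff ℝ ∞ P.factor := by
  unfold factor val
  have h1 := contDiff_softInv P.e_pos
  have h2 := contDiff_softInv P.L_pos
  fun_prop

lemma contDiff_slope : ContDiff ℝ ∞ (fun x : E3 => P.slope (‖x‖ ^ 2)) := by
  unfold slope
  have h1 := contDiff_softInv P.e_pos
  have h2 := contDiff_softInv P.L_pos
  fun_prop

lemma pderiv_factor (i : Fin 3) : pderiv i P.factor = fun x => -(x i * P.slope (‖x‖ ^ 2)) := by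
  funext x
  have h1 := (contDiff_softInv P.e_pos).differentiable (by simp) x
  have h2 := (contDiff_softInv P.L_pos).differentiable (by simp) x
  unfold factor val slope
  rw [pderiv_sub (by fun_prop) (by fun_prop), pderiv_add (by fun_prop) (by fun_prop),
    pderiv_add (by fun_prop) (by fun_prop), pderiv_const, pderiv_const_mul _ h1,
    pderiv_const_mul _ h2, pderiv_const_mul _ (by fun_prop), pderiv_pow 2 h2,
    pderiv_softInv P.e_pos, pderiv_softInv P.L_pos]
  push_cast
  ring

lemma pderiv_slope (i : Fin 3) (x : E3) :
    pderiv i (fun x : E3 => P.slope (‖x‖ ^ 2)) x = -(x i * P.bend (‖x‖ ^ 2)) := by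
  have h1 := (contDiff_softInv P.e_pos).differentiable (by simp) x
  have h2 := (contDiff_softInv P.L_pos).differentiable (by simp) x
  unfold slope bend
  rw [pderiv_sub (by fun_prop) (by fun_prop), pderiv_add (by fun_prop) (by fun_prop),
    pderiv_const_mul _ (by fun_prop), pderiv_const_mul _ (by fun_prop),
    pderiv_const_mul _ (by fun_prop), pderiv_pow 3 h1, pderiv_pow 3 h2, pderiv_pow 4 h2,
    pderiv_softInv P.e_pos, pderiv_softInv P.L_pos]
  push_cast
  ring

lemma pderiv_pderiv_factor (i j : Fin 3) (x : E3) :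
    pderiv j (pderiv i P.factor) x
      = x i * x j * P.bend (‖x‖ ^ 2) - if i = j then P.slope (‖x‖ ^ 2) else 0 := by
  have h1 := P.contDiff_slope.differentiable (by simp) x
  have h2 : (fun x : E3 => -(x i * P.slope (‖x‖ ^ 2)))
      = fun x : E3 => -1 * (x i * P.slope (‖x‖ ^ 2)) := by funext; ring
  rw [pderiv_factor, h2, pderiv_const_mul _ (by fun_prop), pderiv_mul (by fun_prop) h1,
    pderiv_slope, pderiv_coord]
  split_ifs <;> ring

/-- Eliminating r² by `softInv_sq`, the Laplacian becomes -3ae p⁵ - L q⁵(3b - 8cq) - 2cq⁴, where p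
and q are the two softened inverse radii. Every term is nonpositive, and the last is the one kept.
-/
lemma laplacian_factor_le (x : E3) :
    ∑ i, pderiv i (pderiv i P.factor) x ≤ -(2 * P.c * softInv P.L (‖x‖ ^ 2) ^ 4) := by
  simp only [pderiv_pderiv_factor, if_true, Fin.sum_univ_three]
  have ht : 0 ≤ ‖x‖ ^ 2 := by positivity
  have h1 := softInv_sq P.e_pos ht
  have h2 := softInv_sq P.L_pos ht
  have h3 := softInv_pos P.e_pos ht
  have h4 := softInv_pos P.L_pos ht
  have h5 := P.c_softInv_le ht
  have hx := normSq_eq x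
  set p := softInv P.e (‖x‖ ^ 2)
  set q := softInv P.L (‖x‖ ^ 2)
  have key : x 0 * x 0 * P.bend (‖x‖ ^ 2) - P.slope (‖x‖ ^ 2)
      + (x 1 * x 1 * P.bend (‖x‖ ^ 2) - P.slope (‖x‖ ^ 2))
      + (x 2 * x 2 * P.bend (‖x‖ ^ 2) - P.slope (‖x‖ ^ 2))
      = -(3 * P.a * P.e * p ^ 5) - P.L * q ^ 5 * (3 * P.b - 8 * P.c * q) - 2 * P.c * q ^ 4 := by
    have : x 0 * x 0 * P.bend (‖x‖ ^ 2) - P.slope (‖x‖ ^ 2)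
      + (x 1 * x 1 * P.bend (‖x‖ ^ 2) - P.slope (‖x‖ ^ 2))
      + (x 2 * x 2 * P.bend (‖x‖ ^ 2) - P.slope (‖x‖ ^ 2))
      = ‖x‖ ^ 2 * P.bend (‖x‖ ^ 2) - 3 * P.slope (‖x‖ ^ 2) := by rw [hx]; ring
    rw [this]
    change ‖x‖ ^ 2 * (3 * P.a * p ^ 5 + 3 * P.b * q ^ 5 - 8 * P.c * q ^ 6)
      - 3 * (P.a * p ^ 3 + P.b * q ^ 3 - 2 * P.c * q ^ 4) = _
    linear_combination 3 * P.a * p ^ 3 * h1 + (3 * P.b * q ^ 3 - 8 * P.c * q ^ 4) * h2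
  have h6 : 0 ≤ 3 * P.a * P.e * p ^ 5 := by
    have := P.a_nonneg; have := P.e_pos; positivity
  have h7 : 0 ≤ P.L * q ^ 5 * (3 * P.b - 8 * P.c * q) := by
    have := P.L_pos
    exact mul_nonneg (by positivity) (by linarith)
  rw [key]; linarith

lemma scalarCurvature_factor_ge (x : E3) :
    16 * P.c * softInv P.L (‖x‖ ^ 2) ^ 4 / P.factor x ^ 5
      ≤ coordScalarCurvature (conf P.factor) x := by
  rw [coordScalarCurvature_conf P.contDiff_factor P.factor_ne_zero]
  have := P.factor_pos x
  gcongr ?_ / _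
  linarith [P.laplacian_factor_le x]

/-- The mean curvature of the coordinate sphere of squared radius `t`, up to a positive factor. -/
def sphereCurv (t : ℝ) : ℝ := P.val t - 2 * t * P.slope t

end Profile

/-! ### Choice of the parameters -/

/-- The gain of mean convexity of a central source away from the unit sphere. -/
lemma near_source_le {t e p p1 : ℝ} (ht : 1 < t) (he0 : 0 < e) (he : e ≤ 1 / 12) (hp0 : 0 < p)
    (hp10 : 0 < p1) (hp : p ^ 2 * (t + e) = 1) (hp1 : p1 ^ 2 * (1 + e) = 1) :
    (t - 1) * p ^ 2 / 8 ≤ (p1 - p) - 2 * e * (p1 ^ 3 - p ^ 3) := by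
  have t1 : 0 < t - 1 := by linarith
  -- Subtracting the two normalizations turns a difference of inverse square roots into a multiple
  -- of t - 1.
  have hpe : (p1 - p) * (p1 + p) = (t - 1) * (p1 ^ 2 * p ^ 2) := by
    linear_combination p ^ 2 * hp1 - p1 ^ 2 * hp
  have hpp : p < p1 := by
    have : 0 < (p1 - p) * (p1 + p) := by rw [hpe]; positivity
    linarith [(mul_pos_iff_of_pos_right (by positivity)).1 this]
  have hp1l : p1 ≤ 1 := by
    by_contra! h
    nlinarith [mul_pos hp10 hp10]
  have hp1g : 1 / 2 ≤ p1 := by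
    by_contra! h
    nlinarith
  have hP : (t - 1) * p ^ 2 / 4 ≤ p1 - p := by
    by_contra! h
    have h1 : (p1 - p) * (p1 + p) < (t - 1) * p ^ 2 / 4 * (2 * p1) := by
      apply mul_lt_mul h (by linarith) (by linarith) (by positivity)
    rw [hpe] at h1
    have h2 : 0 ≤ (t - 1) * p ^ 2 * p1 * (p1 - 1 / 2) :=
      mul_nonneg (by positivity) (by linarith)
    linarith
  have h2 : p1 ^ 3 - p ^ 3 = (p1 - p) * (p1 ^ 2 + p1 * p + p ^ 2) := by ring
  have h3 : p1 ^ 2 + p1 * p + p ^ 2 ≤ 3 := by nlinarith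
  have h4 : e * (p1 ^ 2 + p1 * p + p ^ 2) ≤ 1 / 12 * 3 :=
    mul_le_mul he h3 (by positivity) (by norm_num)
  -- The correction factor 1 - 2e(p1² + p1 p + p²) is at least 1/2, because e ≤ 1/12 and the bracket
  -- is at most 3. This halves the constant 1/4 of `hP`.
  rw [h2]
  nlinarith [mul_nonneg (sub_nonneg.2 hpp.le) (sub_nonneg.2 h4)]

/-- The loss of mean convexity of a far source away from the unit sphere. -/
lemma far_source_le {t l q q1 : ℝ} (ht : 1 < t) (l0 : 0 < l) (hq0 : 0 < q)
    (hq10 : 0 < q1) (hq : q ^ 2 * (t + l ^ 2) = 1) (hq1 : q1 ^ 2 * (1 + l ^ 2) = 1) :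
    (-(l * q1) + (l * q1) ^ 2 + 2 * (l * q1) ^ 3 - 4 / 3 * (l * q1) ^ 4)
      - (-(l * q) + (l * q) ^ 2 + 2 * (l * q) ^ 3 - 4 / 3 * (l * q) ^ 4)
      ≤ 7 * ((t - 1) * q ^ 2) := by
  have t1 : 0 < t - 1 := by linarith
  have hqe : (q1 - q) * (q1 + q) = (t - 1) * (q1 ^ 2 * q ^ 2) := by
    linear_combination q ^ 2 * hq1 - q1 ^ 2 * hq
  have hqq : q < q1 := by
    have : 0 < (q1 - q) * (q1 + q) := by rw [hqe]; positivity
    linarith [(mul_pos_iff_of_pos_right (by positivity)).1 this]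
  have hz1 : l * q1 ≤ 1 := by
    by_contra! h
    nlinarith [mul_pos hq10 hq10]
  have hQ : l * q1 - l * q ≤ (t - 1) * q ^ 2 := by
    by_contra! h
    have h1 : (t - 1) * q ^ 2 * q1 < (l * q1 - l * q) * (q1 + q) := by
      apply mul_lt_mul h (by linarith) (by positivity)
      nlinarith
    have h3 : (l * q1 - l * q) * (q1 + q) = (t - 1) * q ^ 2 * q1 * (l * q1) := by
      linear_combination l * hqe
    rw [h3] at h1
    nlinarith [show 0 < (t - 1) * q ^ 2 * q1 by positivity]
  have hz : 0 < l * q := by positivity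
  have hzz : l * q < l * q1 := mul_lt_mul_of_pos_left hqq l0
  generalize l * q = z at *
  generalize l * q1 = z1 at *
  -- After division by z1 - z, the bounds z, z1 ≤ 1 give at most -1 + 2 + 6 = 7; the cubic part only
  -- helps.
  have h2 : (-z1 + z1 ^ 2 + 2 * z1 ^ 3 - 4 / 3 * z1 ^ 4)
    - (-z + z ^ 2 + 2 * z ^ 3 - 4 / 3 * z ^ 4) = (z1 - z) * (-1 + (z1 + z)
      + 2 * (z1 ^ 2 + z1 * z + z ^ 2) - 4 / 3 * (z1 ^ 3 + z1 ^ 2 * z + z1 * z ^ 2 + z ^ 3)) := by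
    ring
  have hz10 : 0 < z1 := by linarith
  have h3 : 0 ≤ z1 ^ 3 + z1 ^ 2 * z + z1 * z ^ 2 + z ^ 3 := by positivity
  have h4 : z1 ^ 2 + z1 * z + z ^ 2 ≤ 3 := by nlinarith
  have h5 : (z1 - z) * (-1 + (z1 + z) + 2 * (z1 ^ 2 + z1 * z + z ^ 2)
      - 4 / 3 * (z1 ^ 3 + z1 ^ 2 * z + z1 * z ^ 2 + z ^ 3)) ≤ (z1 - z) * 7 :=
    mul_le_mul_of_nonneg_left (by linarith) (by linarith)
  rw [h2]
  linarith

/-! ### Rescaling, and mean convexity of the outer spheres -/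

namespace Profile

variable (P : Profile)

/-- Substituting t = w⁻² - κ for each source removes t, so spheres can be compared through the
softened inverse radii alone. -/
lemma sphereCurv_eq {t : ℝ} (ht : 0 ≤ t) : P.sphereCurv t =
    1 - P.a * (softInv P.e t - 2 * P.e * softInv P.e t ^ 3)
      + P.b * (2 * P.L * softInv P.L t ^ 3 - softInv P.L t)
      + P.c * (3 * softInv P.L t ^ 2 - 4 * P.L * softInv P.L t ^ 4) := by
  have h1 := softInv_sq P.e_pos ht
  have h2 := softInv_sq P.L_pos ht
  unfold sphereCurv val slope
  linear_combination (-2 * P.a * softInv P.e t) * h1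
    + (-2 * P.b * softInv P.L t + 4 * P.c * softInv P.L t ^ 2) * h2

/-- The profile rescaled by the length `s`. -/
def scale {s : ℝ} (hs : 0 < s) : Profile where
  a := s * P.a
  b := s * P.b
  c := s ^ 2 * P.c
  e := s ^ 2 * P.e
  L := s ^ 2 * P.L
  a_nonneg := mul_nonneg hs.le P.a_nonneg
  c_nonneg := mul_nonneg (by positivity) P.c_nonneg
  e_pos := mul_pos (by positivity) P.e_pos
  L_pos := mul_pos (by positivity) P.L_pos
  le_b := by
    rw [Real.sqrt_mul (by positivity), Real.sqrt_sq hs.le]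
    nlinarith [mul_le_mul_of_nonneg_left P.le_b (sq_nonneg s)]

lemma softInv_scale {s : ℝ} (hs : 0 < s) (κ t : ℝ) :
    softInv (s ^ 2 * κ) (s ^ 2 * t) = s⁻¹ * softInv κ t := by
  rw [softInv, softInv, ← mul_add, Real.sqrt_mul (by positivity), Real.sqrt_sq hs.le, mul_inv]

lemma val_scale {s : ℝ} (hs : 0 < s) (t : ℝ) : (P.scale hs).val (s ^ 2 * t) = P.val t := by
  simp only [val, scale, softInv_scale hs]
  field_simp

lemma slope_scale {s : ℝ} (hs : 0 < s) (t : ℝ) :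
    s ^ 2 * (P.scale hs).slope (s ^ 2 * t) = P.slope t := by
  simp only [slope, scale, softInv_scale hs]
  field_simp

lemma sphereCurv_scale {s : ℝ} (hs : 0 < s) (t : ℝ) :
    (P.scale hs).sphereCurv (s ^ 2 * t) = P.sphereCurv t := by
  rw [sphereCurv, sphereCurv, val_scale, ← P.slope_scale hs]
  ring

/-- If the second source is far away, all the coordinate spheres outside of the unit sphere are
strictly mean convex. -/
lemma sphereCurv_pos {l : ℝ} (hl : 1 ≤ l) (hL : P.L = l ^ 2) (hc : P.c = P.b * l / 3)
    (he : P.e ≤ 1 / 12) (ha : 1 / 2 ≤ P.a) (hb : 112 * P.b < l) (h1 : P.sphereCurv 1 = 0)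
    {t : ℝ} (ht : 1 < t) : 0 < P.sphereCurv t := by
  have hb0 := P.b_nonneg
  have he0 := P.e_pos
  rw [P.sphereCurv_eq zero_le_one] at h1
  rw [P.sphereCurv_eq (by linarith)]
  have hp := softInv_sq P.e_pos (t := t) (by linarith)
  have hq := softInv_sq P.L_pos (t := t) (by linarith)
  have hp0 := softInv_pos P.e_pos (t := t) (by linarith)
  have hq0 := softInv_pos P.L_pos (t := t) (by linarith)
  have hnear := near_source_le ht he0 he hp0 (softInv_pos he0 zero_le_one) hp
    (softInv_sq he0 zero_le_one)
  rw [hc, hL] at h1 ⊢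
  rw [hL] at hq hq0
  have l0 : 0 < l := by linarith
  have hfar := far_source_le ht l0 hq0 (softInv_pos (by positivity) zero_le_one) hq
    (softInv_sq (by positivity) zero_le_one)
  generalize softInv P.e t = p at *
  generalize softInv P.e 1 = p1 at *
  generalize softInv (l ^ 2) t = q at *
  generalize softInv (l ^ 2) 1 = q1 at *
  have hqp : q ^ 2 ≤ p ^ 2 := by
    have hel : P.e ≤ l ^ 2 := by nlinarith
    by_contra! h
    have h2 : p ^ 2 * (t + P.e) < q ^ 2 * (t + l ^ 2) :=
      mul_lt_mul h (by linarith) (by linarith) (by positivity)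
    linarith
  -- With L = l² and c = bl/3, the far source contributes b/l times a fixed quartic in the
  -- scale-free variable l·y.
  have hid : ∀ y : ℝ, P.b * (2 * l ^ 2 * y ^ 3 - y) + P.b * l / 3 * (3 * y ^ 2 - 4 * l ^ 2 * y ^ 4)
      = P.b / l * (-(l * y) + (l * y) ^ 2 + 2 * (l * y) ^ 3 - 4 / 3 * (l * y) ^ 4) := by
    intro y; field_simp; ring
  have hid1 := hid q
  have hid2 := hid q1
  generalize -(l * q) + (l * q) ^ 2 + 2 * (l * q) ^ 3 - 4 / 3 * (l * q) ^ 4 = G at *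
  generalize -(l * q1) + (l * q1) ^ 2 + 2 * (l * q1) ^ 3 - 4 / 3 * (l * q1) ^ 4 = G1 at *
  have hbl : P.b / l < 1 / 112 := by rw [div_lt_div_iff₀ l0 (by norm_num)]; linarith
  have ht1 : 0 < t - 1 := by linarith
  -- Relative to the unit sphere, where the curvature vanishes, the near source gains at least
  -- a(t-1)p²/8 ≥ (t-1)p²/16. The far source loses less than 7(t-1)p²/112, the same bound; hence the
  -- constant 112.
  have hmain : P.b / l * (G1 - G)
      < P.a * ((p1 - p) - 2 * P.e * (p1 ^ 3 - p ^ 3)) := by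
    calc P.b / l * (G1 - G) ≤ P.b / l * (7 * ((t - 1) * q ^ 2)) := by gcongr
      _ ≤ P.b / l * (7 * ((t - 1) * p ^ 2)) := by gcongr
      _ < 1 / 112 * (7 * ((t - 1) * p ^ 2)) := by gcongr
      _ = 1 / 2 * ((t - 1) * p ^ 2 / 8) := by ring
      _ ≤ P.a * ((p1 - p) - 2 * P.e * (p1 ^ 3 - p ^ 3)) := by gcongr
  rw [mul_sub] at hmain
  linarith

end Profile

/-! ### Area-mass ratio by the intermediate value theorem -/

/-- The obstruction to the right area-mass ratio of the unit-scale profile. -/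
def ratioDefect (T p d b β γ : ℝ) : ℝ :=
  4 * ((1 + b * β) / d + b) - T * (1 + (1 + b * β) / d * p + b * γ) ^ 2

/-- In the limit l → ∞ the factor on the unit sphere is 2/(1-e), so for small e the defect is close
to 4(1 + b - T), with root near b = T - 1. The value (T-1)/2 lies safely below this root and 2T
safely above. -/
lemma ratioDefect_neg {T p d e : ℝ} (hT : 1 < T) (he0 : 0 < e) (he1 : e ≤ (T - 1) / 4)
    (he2 : e ≤ 1 / 12) (hd0 : 0 < d) (hde : d * (1 + e) = p * (1 - e)) (hpg : 1 ≤ p * (1 + e)) :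
    ratioDefect T p d ((T - 1) / 2) 0 0 < 0 := by
  have e1 : 0 < 1 - e := by linarith
  have h1 : 1 + 1 / d * p = 2 / (1 - e) := by
    field_simp; linear_combination (-1) * hde
  have h2 : 1 / d ≤ (1 + e) ^ 2 / (1 - e) := by
    rw [div_le_div_iff₀ hd0 e1]
    nlinarith
  have h3 : (1 + e) ^ 2 / (1 - e) * (1 - e) ^ 2 ≤ 1 + e := by
    field_simp; nlinarith
  simp only [ratioDefect, mul_zero, add_zero, h1]
  rw [div_pow, sub_neg, mul_div_assoc', lt_div_iff₀ (by positivity)]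
  have h4 : (1 - e) ^ 2 ≤ 1 := by nlinarith
  have h5 : 1 / d * (1 - e) ^ 2 ≤ 1 + e :=
    (mul_le_mul_of_nonneg_right h2 (sq_nonneg _)).trans h3
  nlinarith

lemma ratioDefect_pos {T p d e : ℝ} (hT : 1 < T) (he0 : 0 < e)
    (he2 : e ≤ 1 / 12) (hd0 : 0 < d) (hde : d * (1 + e) = p * (1 - e)) :
    0 < ratioDefect T p d (2 * T) 0 0 := by
  have e1 : 0 < 1 - e := by linarith
  have h1 : 1 + 1 / d * p = 2 / (1 - e) := by
    field_simp; linear_combination (-1) * hde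
  simp only [ratioDefect, mul_zero, add_zero, h1]
  rw [div_pow, sub_pos, mul_div_assoc', div_lt_iff₀ (by positivity)]
  have h4 : 1 / 2 < (1 - e) ^ 2 := by nlinarith
  have h5 : 0 < 1 / d := by positivity
  nlinarith

/-- The coordinate `l / √(1 + l²)`. -/
def farRatio (l : ℝ) : ℝ := l * softInv (l ^ 2) 1

/-- The contribution of the far source to `sphereCurv` at the unit sphere. -/
def farCurv (l : ℝ) : ℝ :=
  (-farRatio l + farRatio l ^ 2 + 2 * farRatio l ^ 3 - 4 / 3 * farRatio l ^ 4) / l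

/-- The contribution of the far source to the conformal factor at the unit sphere. -/
def farVal (l : ℝ) : ℝ := (farRatio l - farRatio l ^ 2 / 3) / l

lemma farRatio_pos_le {l : ℝ} (hl : 0 < l) : 0 < farRatio l ∧ farRatio l ≤ 1 := by
  have h1 := softInv_sq (κ := l ^ 2) (by positivity) zero_le_one
  have h2 := softInv_pos (κ := l ^ 2) (by positivity) zero_le_one
  refine ⟨by unfold farRatio; positivity, ?_⟩
  by_contra! h
  change 1 < l * softInv (l ^ 2) 1 at h
  nlinarith [mul_pos h2 h2]

lemma abs_farCurv_le {l : ℝ} (hl : 0 < l) : |farCurv l| ≤ 10 / l := by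
  obtain ⟨h1, h2⟩ := farRatio_pos_le hl
  rw [farCurv, abs_div, abs_of_pos hl]
  gcongr
  have h3 : farRatio l ^ 2 ≤ 1 := pow_le_one₀ h1.le h2
  have h4 : farRatio l ^ 3 ≤ 1 := pow_le_one₀ h1.le h2
  have h5 : farRatio l ^ 4 ≤ 1 := pow_le_one₀ h1.le h2
  have h6 := pow_pos h1 2
  have h7 := pow_pos h1 3
  have h8 := pow_pos h1 4
  rw [abs_le]
  constructor <;> linarith

lemma abs_farVal_le {l : ℝ} (hl : 0 < l) : |farVal l| ≤ 10 / l := by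
  obtain ⟨h1, h2⟩ := farRatio_pos_le hl
  rw [farVal, abs_div, abs_of_pos hl]
  gcongr
  have h3 : farRatio l ^ 2 ≤ 1 := pow_le_one₀ h1.le h2
  have h6 := pow_pos h1 2
  rw [abs_le]
  constructor <;> linarith

lemma tendsto_ratioDefect (T p d b : ℝ) :
    Tendsto (fun l => ratioDefect T p d b (farCurv l) (farVal l)) atTop
      (𝓝 (ratioDefect T p d b 0 0)) := by
  have hlim : Tendsto (fun l : ℝ => 10 / l) atTop (𝓝 0) := tendsto_const_nhds.div_atTop tendsto_id
  have hβ : Tendsto farCurv atTop (𝓝 0) :=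
    squeeze_zero_norm' ((eventually_gt_atTop 0).mono fun l hl => by
      rw [Real.norm_eq_abs]; exact abs_farCurv_le hl) hlim
  have hγ : Tendsto farVal atTop (𝓝 0) :=
    squeeze_zero_norm' ((eventually_gt_atTop 0).mono fun l hl => by
      rw [Real.norm_eq_abs]; exact abs_farVal_le hl) hlim
  unfold ratioDefect
  exact ((((hβ.const_mul b).const_add 1).div_const d).add_const b |>.const_mul 4).sub
    (((((hβ.const_mul b).const_add 1).div_const d).mul_const p |>.const_add 1 |>.add
      (hγ.const_mul b)).pow 2 |>.const_mul T)

/-- The limiting defect changes sign on [(T-1)/2, 2T]. Both strict signs persist for large l, so l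
is fixed first and b is then found by continuity. -/
lemma exists_far_source {T p d K : ℝ} (hT : 1 < T)
    (hlow : ratioDefect T p d ((T - 1) / 2) 0 0 < 0) (hhigh : 0 < ratioDefect T p d (2 * T) 0 0) :
    ∃ l b : ℝ, 1 ≤ l ∧ 112 * b < l ∧ 0 < b ∧ b ≤ 2 * T ∧ |b * farCurv l| ≤ 1 / 2 ∧
      ratioDefect T p d b (farCurv l) (farVal l) = 0 ∧ K ≤ b * l / 3 := by
  -- As b ≤ 2T, l > 224T gives 112b < l; as b ≥ (T-1)/2, l ≥ 6K/(T-1) gives bl/3 ≥ K.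
  obtain ⟨l, hl1, hl2, hl3, hl4, hl5⟩ := (((tendsto_ratioDefect ..).eventually_lt_const hlow).and
    (((tendsto_ratioDefect ..).eventually_const_lt hhigh).and ((eventually_ge_atTop 1).and
    ((eventually_gt_atTop (224 * T)).and (eventually_ge_atTop (K * 6 / (T - 1))))))).exists
  have l0 : 0 < l := by linarith
  have hbc : ContinuousOn (fun b => ratioDefect T p d b (farCurv l) (farVal l))
      (Set.Icc ((T - 1) / 2) (2 * T)) := by
    unfold ratioDefect; fun_prop
  obtain ⟨b, ⟨hb1, hb2⟩, hb⟩ := intermediate_value_Icc (by linarith) hbc ⟨hl1.le, hl2.le⟩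
  have hb0 : 0 < b := by linarith
  refine ⟨l, b, hl3, by linarith, hb0, hb2, ?_, hb, ?_⟩
  · rw [abs_mul, abs_of_pos hb0]
    calc b * |farCurv l| ≤ 2 * T * (10 / l) := by
          gcongr
          exact abs_farCurv_le l0
      _ ≤ 1 / 2 := by
          rw [mul_div_assoc', div_le_div_iff₀ l0 (by norm_num)]; linarith
  · rw [div_le_iff₀ (by linarith)] at hl5
    nlinarith

/-- The bound on a + b does not involve K. This matters because the later dilation multiplies c by a
square that must be bounded below before K is chosen. -/
lemma exists_unit_profile {T : ℝ} (K : ℝ) (hT : 1 < T) :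
    ∃ P : Profile, P.sphereCurv 1 = 0 ∧ (∀ t > 1, 0 < P.sphereCurv t) ∧
      4 * (P.a + P.b) = T * P.val 1 ^ 2 ∧ 0 < P.a + P.b ∧ P.a + P.b ≤ 3 + 2 * T ∧ K ≤ P.c := by
  obtain ⟨e, he0, he1, he2⟩ : ∃ e : ℝ, 0 < e ∧ e ≤ (T - 1) / 4 ∧ e ≤ 1 / 12 :=
    ⟨min ((T - 1) / 4) (1 / 12), lt_min (by linarith) (by norm_num), min_le_left _ _,
      min_le_right _ _⟩
  obtain ⟨p, hp⟩ : ∃ p, p = softInv e 1 := ⟨_, rfl⟩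
  have hp0 : 0 < p := hp ▸ softInv_pos he0 zero_le_one
  have hp1 : p ^ 2 * (1 + e) = 1 := hp ▸ softInv_sq he0 zero_le_one
  have hpl : p ≤ 1 := by
    by_contra! h
    nlinarith
  have hpg : 1 ≤ p * (1 + e) := by nlinarith
  -- The unit sphere is minimal exactly when a·d = 1 + b·`farCurv l`, which is solved for a.
  obtain ⟨d, hd⟩ : ∃ d, d = p - 2 * e * p ^ 3 := ⟨_, rfl⟩
  have hde : d * (1 + e) = p * (1 - e) := by rw [hd]; linear_combination (-2 * e * p) * hp1
  have hd1 : d ≤ 1 := by rw [hd]; nlinarith [show 0 < e * p ^ 3 by positivity]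
  have hd2 : 1 / 2 ≤ d := by nlinarith
  have hd0 : 0 < d := by linarith
  obtain ⟨l, b, hl, hbl, hb0, hbT, hbβ, hb, hK⟩ := exists_far_source (K := K) hT
    (ratioDefect_neg hT he0 he1 he2 hd0 hde hpg) (ratioDefect_pos hT he0 he2 hd0 hde)
  have l0 : 0 < l := by linarith
  obtain ⟨hβ1, hβ2⟩ := abs_le.1 hbβ
  have ha1 : 1 / 2 ≤ (1 + b * farCurv l) / d := by
    rw [le_div_iff₀ hd0]; linarith
  have ha2 : (1 + b * farCurv l) / d ≤ 3 := by
    rw [div_le_iff₀ hd0]; linarith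
  let P : Profile :=
    { a := (1 + b * farCurv l) / d
      b := b
      c := b * l / 3
      e := e
      L := l ^ 2
      a_nonneg := by linarith
      c_nonneg := by positivity
      e_pos := he0
      L_pos := by positivity
      le_b := by rw [Real.sqrt_sq l0.le]; nlinarith [mul_pos hb0 l0] }
  have hcurv : P.sphereCurv 1 = 0 := by
    rw [P.sphereCurv_eq zero_le_one]
    change 1 - (1 + b * farCurv l) / d * (softInv e 1 - 2 * e * softInv e 1 ^ 3)
      + b * (2 * l ^ 2 * softInv (l ^ 2) 1 ^ 3 - softInv (l ^ 2) 1)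
      + b * l / 3 * (3 * softInv (l ^ 2) 1 ^ 2 - 4 * l ^ 2 * softInv (l ^ 2) 1 ^ 4) = 0
    rw [← hp, ← hd, div_mul_cancel₀ _ hd0.ne']
    simp only [farCurv, farRatio]
    field_simp
    ring
  refine ⟨P, hcurv, fun t ht => P.sphereCurv_pos hl rfl rfl he2 ha1 hbl hcurv ht, ?_, ?_, ?_, hK⟩
  · change 4 * ((1 + b * farCurv l) / d + b) = T * (1 + (1 + b * farCurv l) / d * softInv e 1
      + b * softInv (l ^ 2) 1 - b * l / 3 * softInv (l ^ 2) 1 ^ 2) ^ 2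
    have h1 : b * softInv (l ^ 2) 1 - b * l / 3 * softInv (l ^ 2) 1 ^ 2 = b * farVal l := by
      simp only [farVal, farRatio]
      field_simp
    rw [add_sub_assoc, h1, ← hp]
    exact sub_eq_zero.1 hb
  · change 0 < (1 + b * farCurv l) / d + b
    linarith
  · change (1 + b * farCurv l) / d + b ≤ 3 + 2 * T
    linarith

/-- There is a conformal factor with prescribed mass whose outermost minimal coordinate sphere has
prescribed area radius, and with as much scalar curvature as one likes. -/
theorem exists_profile {μ m Q : ℝ} (hμ : 0 < μ) (hm : μ < m) :
    ∃ (P : Profile) (ρ : ℝ), 0 < ρ ∧ Q ^ 2 ≤ 8 * P.c ∧ P.a + P.b = m / 2 ∧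
      P.sphereCurv (ρ ^ 2) = 0 ∧ (∀ r > ρ, 0 < P.sphereCurv (r ^ 2)) ∧
      ρ * P.val (ρ ^ 2) ^ 2 = 2 * μ := by
  have hm0 : 0 < m := hμ.trans hm
  set T := m / μ with hTd
  have hT : 1 < T := (one_lt_div hμ).2 hm
  -- The dilation factor s is at least m/(2(3+2T)) for every K, so this K forces Q² ≤ 8s²c.
  obtain ⟨P, h1, h2, h3, h4, h5, h6⟩ :=
    exists_unit_profile (Q ^ 2 * (2 * (3 + 2 * T)) ^ 2 / (8 * m ^ 2)) hT
  set s := m / (2 * (P.a + P.b)) with hs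
  have hs0 : 0 < s := by positivity
  clear_value s
  have hval : (P.scale hs0).val (s ^ 2) = P.val 1 := by simpa using P.val_scale hs0 1
  refine ⟨P.scale hs0, s, hs0, ?_, ?_, ?_, ?_, ?_⟩
  · change Q ^ 2 ≤ 8 * (s ^ 2 * P.c)
    have hK : m / (2 * (3 + 2 * T)) ≤ s := by rw [hs]; gcongr
    have hT0 : 0 < 3 + 2 * T := by linarith
    calc Q ^ 2 = 8 * ((m / (2 * (3 + 2 * T))) ^ 2 *
          (Q ^ 2 * (2 * (3 + 2 * T)) ^ 2 / (8 * m ^ 2))) := by field_simp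
      _ ≤ 8 * (s ^ 2 * P.c) := by gcongr
  · change s * P.a + s * P.b = m / 2
    rw [hs]; field_simp
  · simpa [h1] using P.sphereCurv_scale hs0 1
  · intro r hr
    have h7 := P.sphereCurv_scale hs0 ((r / s) ^ 2)
    rw [← mul_pow, show s * (r / s) = r by field_simp] at h7
    rw [h7]
    exact h2 _ (one_lt_pow₀ ((one_lt_div hs0).2 hr) (by norm_num))
  · rw [hval]
    have h8 : P.val 1 ^ 2 = 4 * (P.a + P.b) * μ / m := by
      rw [h3, hTd]; field_simp
    rw [h8, hs]; field_simp; norm_num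

/-! ### Conformally flat structures on `ℝ³` -/

/-- The conformally flat metric `u⁴ δ` on `ℝ³`. -/
def confMetric (u : E3 → ℝ) (hu : ContDiff ℝ ∞ u) (h0 : ∀ x, u x ≠ 0) : Metric E3 where
  inner x := (u x ^ 4 • innerSL ℝ (E := E3) : E3 →L[ℝ] E3 →L[ℝ] ℝ)
  symm x v w := by
    exact congrArg (u x ^ 4 * ·) (real_inner_comm (F := E3) w v)
  pos x v hv := by
    have := h0 x
    exact mul_pos (by positivity) (real_inner_self_pos (F := E3).2 hv)
  isVonNBounded x := by
    -- The unit ball of the metric at x is the Euclidean ball of radius u⁻².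
    have h4 : 0 < u x ^ 4 := by have := h0 x; positivity
    refine (NormedSpace.isVonNBounded_ball ℝ E3 (√(u x ^ 4)⁻¹)).subset ?_
    intro v hv
    change u x ^ 4 * inner ℝ (v : E3) (v : E3) < 1 at hv
    rw [real_inner_self_eq_norm_sq] at hv
    rw [mem_ball_zero_iff]
    apply Real.lt_sqrt_of_sq_lt
    rwa [← mul_one (u x ^ 4)⁻¹, lt_inv_mul_iff₀ h4]
  contMDiff := by
    exact (hu.pow 4).contMDiff.smul_section
      ((riemannianMetricVectorSpace E3).contMDiff.of_le le_top)

/-- The vector field on `ℝ³` with given components. -/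
def vfield (v : E3 → E3) (hv : ContDiff ℝ ∞ v) : VField E3 where
  toFun := v
  contMDiff_toFun := contMDiff_vectorSpace_iff_contDiff.2 hv

/-- The end of `ℝ³`, with the identity as coordinates outside of the unit ball. -/
def standardEnd : End E3 where
  chart := OpenPartialHomeomorph.ofSet (Metric.closedBall (0 : E3) 1)ᶜ
    Metric.isClosed_closedBall.isOpen_compl
  chart_mem := by
    apply StructureGroupoid.mem_maximalAtlas_of_mem_groupoid
    exact ofSet_mem_contDiffGroupoid _
  radius := 1
  radius_pos := one_pos
  target_eq := rfl
  isCompact_compl := by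
    simpa using isCompact_closedBall (0 : E3) 1
  isCompact_inside r _ := by
    have : ((fun x : E3 => x) '' {x : E3 | r < ‖x‖})ᶜ = Metric.closedBall (0 : E3) r := by
      ext x; simp
    change IsCompact ((fun x : E3 => x) '' {x : E3 | r < ‖x‖})ᶜ
    rw [this]
    exact isCompact_closedBall 0 r

section

variable {u : E3 → ℝ} (hu : ContDiff ℝ ∞ u) (h0 : ∀ x, u x ≠ 0)

lemma gram_confMetric {n : ℕ} (X : EuclideanSpace ℝ (Fin n) → E3) (x : EuclideanSpace ℝ (Fin n))
    (i j : Fin n) : gram (confMetric u hu h0) X x i j =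
      u (X x) ^ 4 * inner ℝ (fderiv ℝ X x (EuclideanSpace.single i 1))
        (fderiv ℝ X x (EuclideanSpace.single j 1)) := by
  rw [gram, mfderiv_eq_fderiv]
  rfl

lemma gram_confMetric_id : gram (confMetric u hu h0) (fun x : E3 => x) = conf u := by
  ext x i j
  rw [gram_confMetric, conf_apply, fderiv_fun_id]
  simp [EuclideanSpace.inner_single_left]

lemma scalarCurvature_confMetric (p : E3) :
    scalarCurvature (confMetric u hu h0) p = coordScalarCurvature (conf u) p := by
  rw [← gram_confMetric_id hu h0]; rfl

lemma meanCurvature_confMetric (f : E3 → ℝ) (p : E3) :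
    meanCurvature (confMetric u hu h0) f p = coordMeanCurvature (conf u) f p := by
  rw [← gram_confMetric_id hu h0]; rfl

lemma standardEnd_metric : standardEnd.metric (confMetric u hu h0) = conf u := by
  rw [← gram_confMetric_id hu h0]; rfl

lemma standardEnd_field (v : E3 → E3) (hv : ContDiff ℝ ∞ v) (i : Fin 3) :
    standardEnd.field (vfield v hv) i = fun x => v x i := by
  funext x
  have h : mfderiv (𝓡 3) (𝓡 3) (fun y : E3 => y) x = ContinuousLinearMap.id ℝ E3 := by
    rw [mfderiv_eq_fderiv, fderiv_fun_id]
  exact congrArg (fun (A : E3 →L[ℝ] E3) => A (v x) i) h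

end

/-! ### The area of a coordinate sphere -/

/-- The Euclidean plane. -/
abbrev E2 : Type := EuclideanSpace ℝ (Fin 2)

/-- The inclusion of the horizontal plane. -/
def planeIncl : E2 →L[ℝ] E3 :=
  LinearMap.toContinuousLinearMap
    { toFun := fun y => !₂[y 0, y 1, 0]
      map_add' := fun y z => by ext i; fin_cases i <;> simp
      map_smul' := fun c y => by ext i; fin_cases i <;> simp }

lemma planeIncl_apply (y : E2) : planeIncl y = !₂[y 0, y 1, 0] := rfl

lemma inner_planeIncl (y z : E2) : inner ℝ (planeIncl y) (planeIncl z) = inner ℝ y z := by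
  simp [planeIncl_apply, PiLp.inner_apply, Fin.sum_univ_three]

/-- The vertical unit vector. -/
def vert : E3 := EuclideanSpace.single 2 1

lemma inner_planeIncl_vert (y : E2) : inner ℝ (planeIncl y) vert = 0 := by
  simp [planeIncl_apply, vert, EuclideanSpace.inner_single_right]

lemma inner_vert : inner ℝ vert vert = 1 := by
  simp [vert]

/-- The stereographic parametrization of the sphere of radius `ρ` from the pole `σ ρ`. -/
def stereo (ρ σ : ℝ) (y : E2) : E3 :=
  (2 * ρ * (1 + ‖y‖ ^ 2)⁻¹) • (planeIncl y - σ • vert) + (σ * ρ) • vert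

lemma one_add_normSq_ne (y : E2) : 1 + ‖y‖ ^ 2 ≠ 0 := by positivity

lemma contDiff_stereo (ρ σ : ℝ) : ContDiff ℝ ∞ (stereo ρ σ) := by
  have h : ContDiff ℝ ∞ (fun y : E2 => (1 + ‖y‖ ^ 2)⁻¹) :=
    (contDiff_const.add (contDiff_norm_sq ℝ)).inv one_add_normSq_ne
  exact ((contDiff_const.mul h).smul (planeIncl.contDiff.sub contDiff_const)).add contDiff_const

lemma fderiv_stereo (ρ σ : ℝ) (y v : E2) : fderiv ℝ (stereo ρ σ) y v =
    (2 * ρ) • ((1 + ‖y‖ ^ 2)⁻¹ • planeIncl v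
      - (2 * inner ℝ y v * ((1 + ‖y‖ ^ 2)⁻¹) ^ 2) • (planeIncl y - σ • vert)) := by
  have h1 : HasFDerivAt (fun y : E2 => 1 + ‖y‖ ^ 2) (2 • innerSL ℝ y) y :=
    (hasStrictFDerivAt_norm_sq y).hasFDerivAt.const_add 1
  have h2 := ((hasDerivAt_inv (one_add_normSq_ne y)).comp_hasFDerivAt y h1).const_mul (2 * ρ)
  have h3 := (h2.smul (planeIncl.hasFDerivAt.sub_const (σ • vert) (x := y))).add_const
    ((σ * ρ) • vert)
  have h4 : fderiv ℝ (stereo ρ σ) y = _ := h3.fderiv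
  rw [h4]
  simp only [add_apply, smul_apply, ContinuousLinearMap.smulRight_apply, Function.comp_apply,
    innerSL_apply_apply, smul_eq_mul, nsmul_eq_mul]
  rw [inv_pow]
  push_cast
  module

/-- Conformality of stereographic projection: the cross terms cancel because the vector from the
pole to the plane point has squared length 1 + ‖y‖². -/
lemma inner_fderiv_stereo {ρ σ : ℝ} (hσ : σ ^ 2 = 1) (y v w : E2) :
    inner ℝ (fderiv ℝ (stereo ρ σ) y v) (fderiv ℝ (stereo ρ σ) y w)
      = 4 * ρ ^ 2 * ((1 + ‖y‖ ^ 2)⁻¹) ^ 2 * inner ℝ v w := by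
  have hN : (1 + ‖y‖ ^ 2)⁻¹ * (1 + ‖y‖ ^ 2) = 1 := inv_mul_cancel₀ (one_add_normSq_ne y)
  rw [fderiv_stereo, fderiv_stereo]
  simp only [inner_smul_left, inner_smul_right, inner_sub_left, inner_sub_right, inner_planeIncl,
    inner_planeIncl_vert, real_inner_comm (planeIncl _) vert, inner_vert,
    real_inner_comm y v]
  simp only [conj_trivial, real_inner_self_eq_norm_sq]
  generalize (1 + ‖y‖ ^ 2)⁻¹ = d at *
  linear_combination (16 * ρ ^ 2 * d ^ 3 * inner ℝ y v * inner ℝ y w) * hN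
    + (16 * ρ ^ 2 * d ^ 4 * inner ℝ y v * inner ℝ y w) * hσ

lemma norm_stereo {ρ σ : ℝ} (hρ : 0 < ρ) (hσ : σ ^ 2 = 1) (y : E2) : ‖stereo ρ σ y‖ = ρ := by
  have hN : (1 + ‖y‖ ^ 2)⁻¹ * (1 + ‖y‖ ^ 2) = 1 := inv_mul_cancel₀ (one_add_normSq_ne y)
  rw [← sq_eq_sq₀ (norm_nonneg _) hρ.le, ← real_inner_self_eq_norm_sq, stereo]
  simp only [inner_smul_left, inner_smul_right, inner_sub_left, inner_sub_right, inner_planeIncl,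
    inner_add_left, inner_add_right,
    inner_planeIncl_vert, real_inner_comm (planeIncl _) vert, inner_vert]
  simp only [conj_trivial, real_inner_self_eq_norm_sq]
  generalize (1 + ‖y‖ ^ 2)⁻¹ = d at *
  linear_combination (4 * ρ ^ 2 * d) * hN + (4 * ρ ^ 2 * d ^ 2 - 4 * ρ ^ 2 * d + ρ ^ 2) * hσ

lemma stereo_apply_two (ρ σ : ℝ) (y : E2) :
    stereo ρ σ y 2 = σ * ρ * (1 - 2 * (1 + ‖y‖ ^ 2)⁻¹) := by
  simp [stereo, planeIncl_apply, vert]; ring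

lemma stereo_apply_zero (ρ σ : ℝ) (y : E2) :
    stereo ρ σ y 0 = 2 * ρ * (1 + ‖y‖ ^ 2)⁻¹ * y 0 := by
  simp [stereo, planeIncl_apply, vert]

lemma stereo_apply_one (ρ σ : ℝ) (y : E2) :
    stereo ρ σ y 1 = 2 * ρ * (1 + ‖y‖ ^ 2)⁻¹ * y 1 := by
  simp [stereo, planeIncl_apply, vert]

lemma stereo_injective {ρ σ : ℝ} (hρ : 0 < ρ) (hσ : σ ^ 2 = 1) :
    Function.Injective (stereo ρ σ) := by
  intro y z h
  have hσ0 : σ ≠ 0 := by rintro rfl; norm_num at hσ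
  have h2 : (1 + ‖y‖ ^ 2)⁻¹ = (1 + ‖z‖ ^ 2)⁻¹ := by
    have := congrArg (fun p : E3 => p 2) h
    simp only [stereo_apply_two] at this
    have := mul_left_cancel₀ (mul_ne_zero hσ0 hρ.ne') this
    linarith
  have hd : 2 * ρ * (1 + ‖z‖ ^ 2)⁻¹ ≠ 0 := by positivity
  have h0 := congrArg (fun p : E3 => p 0) h
  have h1 := congrArg (fun p : E3 => p 1) h
  simp only [stereo_apply_zero, stereo_apply_one, h2] at h0 h1
  ext i
  fin_cases i
  · exact mul_left_cancel₀ hd h0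
  · exact mul_left_cancel₀ hd h1

lemma stereo_ne_pole {ρ σ : ℝ} (hρ : 0 < ρ) (hσ : σ ^ 2 = 1) (y : E2) :
    stereo ρ σ y ≠ (σ * ρ) • vert := by
  intro h
  have hσ0 : σ ≠ 0 := by rintro rfl; norm_num at hσ
  have h2 := congrArg (fun p : E3 => p 2) h
  have h3 : 0 < (1 + ‖y‖ ^ 2)⁻¹ := by positivity
  simp only [stereo_apply_two] at h2
  have h4 : σ * ρ * (1 - 2 * (1 + ‖y‖ ^ 2)⁻¹) = σ * ρ * 1 := by
    rw [h2]; simp [vert]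
  have := mul_left_cancel₀ (mul_ne_zero hσ0 hρ.ne') h4
  linarith

lemma stereo_zero (ρ σ : ℝ) : stereo ρ σ 0 = (-σ * ρ) • vert := by
  simp only [stereo, map_zero, norm_zero]
  norm_num
  module

lemma exists_stereo_eq {ρ : ℝ} (hρ : 0 < ρ) {p : E3} (hp : ‖p‖ = ρ) (h : p ≠ ρ • vert) :
    ∃ y, stereo ρ 1 y = p := by
  have h1 := normSq_eq p
  rw [hp] at h1
  have h2 : 0 < ρ - p 2 := by
    have h3 : p 2 ≤ ρ := by
      by_contra! h3
      nlinarith [sq_nonneg (p 0), sq_nonneg (p 1)]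
    refine lt_of_le_of_ne (by linarith) fun h4 => h ?_
    have h5 : p 2 = ρ := by linarith
    have h6 : p 0 ^ 2 + p 1 ^ 2 = 0 := by rw [h5] at h1; linarith
    ext i
    fin_cases i
    · simp [vert]; nlinarith [sq_nonneg (p 0), sq_nonneg (p 1)]
    · simp [vert]; nlinarith [sq_nonneg (p 0), sq_nonneg (p 1)]
    · simp [vert, h5]
  have hN : (1 + ‖(!₂[p 0 / (ρ - p 2), p 1 / (ρ - p 2)] : E2)‖ ^ 2)⁻¹ = (ρ - p 2) / (2 * ρ) := by
    rw [EuclideanSpace.norm_sq_eq, Fin.sum_univ_two]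
    simp only [Real.norm_eq_abs, sq_abs]
    rw [inv_eq_iff_eq_inv, inv_div]
    simp
    field_simp
    linarith
  refine ⟨!₂[p 0 / (ρ - p 2), p 1 / (ρ - p 2)], ?_⟩
  ext i
  fin_cases i
  · change stereo ρ 1 _ 0 = p 0
    rw [stereo_apply_zero, hN]; simp; field_simp
  · change stereo ρ 1 _ 1 = p 1
    rw [stereo_apply_one, hN]; simp; field_simp
  · change stereo ρ 1 _ 2 = p 2
    rw [stereo_apply_two, hN]; field_simp; ring

lemma hasDerivAt_stereo_primitive (r : ℝ) :
    HasDerivAt (fun r : ℝ => -(1 + r ^ 2)⁻¹ / 2) (r * ((1 + r ^ 2)⁻¹) ^ 2) r := by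
  have h : HasDerivAt (fun r : ℝ => 1 + r ^ 2) (2 * r) r := by
    simpa using (hasDerivAt_pow 2 r).const_add 1
  have h0 : 1 + r ^ 2 ≠ 0 := by positivity
  refine ((h.inv h0).neg.div_const 2).congr_deriv ?_
  field_simp

lemma tendsto_stereo_primitive :
    Tendsto (fun r : ℝ => -(1 + r ^ 2)⁻¹ / 2) atTop (𝓝 0) := by
  have h : Tendsto (fun r : ℝ => 1 + r ^ 2) atTop atTop :=
    tendsto_atTop_add_const_left _ _ (tendsto_pow_atTop (by norm_num))
  simpa using h.inv_tendsto_atTop.neg.div_const 2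

lemma integrable_stereo_density : Integrable (fun y : E2 => ((1 + ‖y‖ ^ 2)⁻¹) ^ 2) := by
  rw [integrable_fun_norm_addHaar volume (f := fun r : ℝ => ((1 + r ^ 2)⁻¹) ^ 2)]
  simp only [finrank_euclideanSpace, Fintype.card_fin, Nat.add_one_sub_one, pow_one, smul_eq_mul]
  exact integrableOn_Ioi_deriv_of_nonneg' (fun r _ => hasDerivAt_stereo_primitive r)
    (fun r hr => by have : 0 < r := hr; positivity) tendsto_stereo_primitive

/-- In polar coordinates this is 2π times the integral of r(1+r²)⁻², which has an explicit
primitive. -/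
lemma integral_stereo_density : ∫ y : E2, ((1 + ‖y‖ ^ 2)⁻¹) ^ 2 = Real.pi := by
  rw [integral_fun_norm_addHaar volume (fun r : ℝ => ((1 + r ^ 2)⁻¹) ^ 2)]
  simp only [finrank_euclideanSpace, Fintype.card_fin, Nat.add_one_sub_one, pow_one, smul_eq_mul]
  rw [integral_Ioi_of_hasDerivAt_of_nonneg' (fun r _ => hasDerivAt_stereo_primitive r)
    (fun r hr => by have : 0 < r := hr; positivity) tendsto_stereo_primitive]
  rw [measureReal_def, EuclideanSpace.volume_ball_fin_two]
  simp [Real.pi_pos.le]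
  ring

/-- The coordinate sphere of radius `ρ` has area `4πρ²u⁴`. -/
theorem hasArea_sphere {u : E3 → ℝ} (hu : ContDiff ℝ ∞ u) (h0 : ∀ x, u x ≠ 0) {ρ U : ℝ}
    (hρ : 0 < ρ) (hU : ∀ x, ‖x‖ = ρ → u x = U) :
    HasArea (confMetric u hu h0) (Metric.sphere 0 ρ) (4 * Real.pi * ρ ^ 2 * U ^ 4) := by
  have hgram {σ : ℝ} (hσ : σ ^ 2 = 1) (y : E2) :
      Real.sqrt (gram (confMetric u hu h0) (stereo ρ σ) y).det
        = 4 * ρ ^ 2 * U ^ 4 * ((1 + ‖y‖ ^ 2)⁻¹) ^ 2 := by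
    rw [Matrix.det_fin_two]
    simp only [gram_confMetric, inner_fderiv_stereo hσ, hU _ (norm_stereo hρ hσ y)]
    simp only [EuclideanSpace.inner_single_left, PiLp.single_apply]
    rw [Real.sqrt_eq_iff_mul_self_eq_of_pos (by
        have : U ≠ 0 := by rw [← hU _ (norm_stereo hρ hσ y)]; exact h0 _
        positivity)]
    simp
    ring
  set s : Fin 2 → ℝ := fun k => if k = 0 then 1 else -1 with hs
  have hσ (k : Fin 2) : s k ^ 2 = 1 := by fin_cases k <;> simp [hs]
  -- The second chart only supplies the missing pole, as a one-point piece of zero area.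
  have him : stereo ρ 1 '' Set.univ ∪ stereo ρ (-1) '' {0} = Metric.sphere 0 ρ := by
    ext p
    simp only [Set.image_univ, Set.image_singleton, Set.mem_union, Set.mem_range,
      Set.mem_singleton_iff, mem_sphere_zero_iff_norm]
    constructor
    · rintro (⟨y, rfl⟩ | rfl) <;> exact norm_stereo hρ (by norm_num) _
    · intro hp
      by_cases h : p = ρ • vert
      · right; rw [stereo_zero, h]; simp
      · left; exact exists_stereo_eq hρ hp h
  have hdis : Disjoint (stereo ρ 1 '' Set.univ) (stereo ρ (-1) '' {0}) := by
    rw [Set.disjoint_left]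
    rintro _ ⟨y, _, rfl⟩ h
    rw [Set.image_singleton, Set.mem_singleton_iff, stereo_zero] at h
    exact stereo_ne_pole (σ := 1) hρ (by norm_num) y (by simpa using h)
  refine ⟨2, fun k => stereo ρ (s k), fun _ => Set.univ, fun k => if k = 0 then Set.univ else {0},
    fun k => ⟨isOpen_univ, ?_, Set.subset_univ _, (stereo_injective hρ (hσ k)).injOn, ?_, ?_, ?_,
      ?_⟩, ?_, ?_, ?_⟩
  · dsimp only; split_ifs
    · exact MeasurableSet.univ
    · exact measurableSet_singleton _
  · intro y _
    simpa using norm_stereo hρ (hσ k) y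
  · exact (contDiff_stereo ρ (s k)).contMDiff.contMDiffOn
  · intro y _
    rw [mfderiv_eq_fderiv]
    change Function.Injective (fderiv ℝ (stereo ρ (s k)) y)
    rw [injective_iff_map_eq_zero]
    intro v hv
    have h1 := inner_fderiv_stereo (ρ := ρ) (hσ k) y v v
    rw [hv, inner_zero_left, real_inner_self_eq_norm_sq] at h1
    have h2 : 4 * ρ ^ 2 * ((1 + ‖y‖ ^ 2)⁻¹) ^ 2 ≠ 0 := by positivity
    exact norm_eq_zero.1 (pow_eq_zero_iff two_ne_zero |>.1
      ((mul_eq_zero.1 h1.symm).resolve_left h2))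
  · simp only [hgram (hσ k)]
    exact (integrable_stereo_density.const_mul _).integrableOn
  · rw [← him]
    ext p
    simp [hs, or_comm, eq_comm]
  · intro k l hkl
    fin_cases k <;> fin_cases l <;> simp [hs] at hkl ⊢
    · simpa using hdis
    · simpa using hdis.symm
  · simp only [hgram (hσ _), Fin.sum_univ_two]
    simp only [if_true, Measure.restrict_univ, integral_const_mul, integral_stereo_density]
    simp
    ring

/-! ### Comparison of a surface with an enclosing coordinate sphere -/

/-- A negative second derivative would make the minimum also a local maximum, so the function would
be locally constant. -/
lemma deriv_deriv_nonneg_of_isLocalMin {k : ℝ → ℝ} {a : ℝ} (h : IsLocalMin k a)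
    (hc : ContinuousAt k a) : 0 ≤ deriv (deriv k) a := by
  by_contra! hneg
  have hmax := isLocalMax_of_deriv_deriv_neg hneg h.deriv_eq_zero hc
  have hconst : k =ᶠ[𝓝 a] fun _ => k a := by
    filter_upwards [h, hmax] with t h1 h2 using le_antisymm h2 h1
  have h1 : deriv k =ᶠ[𝓝 a] fun _ => 0 := by
    filter_upwards [hconst.eventuallyEq_nhds] with t ht
    rw [ht.deriv_eq, deriv_const]
  rw [h1.deriv_eq, deriv_const] at hneg
  exact lt_irrefl 0 hneg

lemma fderiv_eq_sum (f : E3 → ℝ) (x v : E3) : fderiv ℝ f x v = ∑ i, v i * pderiv i f x := by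
  have hv : v = ∑ i, v i • EuclideanSpace.single i (1 : ℝ) := by
    ext j; simp [Fin.sum_univ_three]; fin_cases j <;> simp
  conv_lhs => rw [hv, map_sum]
  simp [pderiv]

lemma hasDerivAt_comp_curve {f : E3 → ℝ} {γ : ℝ → E3} {t : ℝ} {v : E3}
    (hf : DifferentiableAt ℝ f (γ t)) (hγ : HasDerivAt γ v t) :
    HasDerivAt (fun s => f (γ s)) (∑ i, v i * pderiv i f (γ t)) t := by
  rw [← fderiv_eq_sum]
  exact hf.hasFDerivAt.comp_hasDerivAt t hγ

/-- The parabola `p + t v - κ t² p`. -/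
def parabola (p v : E3) (κ t : ℝ) : E3 := p + t • v - (κ * t ^ 2) • p

lemma parabola_zero (p v : E3) (κ : ℝ) : parabola p v κ 0 = p := by simp [parabola]

lemma hasDerivAt_parabola (p v : E3) (κ t : ℝ) :
    HasDerivAt (parabola p v κ) (v - (2 * κ * t) • p) t := by
  have h1 : HasDerivAt (fun t : ℝ => t • v) ((1 : ℝ) • v) t := (hasDerivAt_id t).smul_const v
  have h2 : HasDerivAt (fun t : ℝ => (κ * t ^ 2) • p) ((κ * (2 * t)) • p) t := by
    have := ((hasDerivAt_pow 2 t).const_mul κ).smul_const p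
    simpa using this
  refine ((h1.const_add p).sub h2).congr_deriv ?_
  module

lemma continuous_parabola (p v : E3) (κ : ℝ) : Continuous (parabola p v κ) :=
  continuous_iff_continuousAt.2 fun t => (hasDerivAt_parabola p v κ t).continuousAt

/-- The squared norm is ‖p‖² + t²(‖v‖² - 2κ‖p‖²) + κ²t⁴‖p‖². Equality in the bound on κ gives the
curve its full spherical curvature while it stays outside the ball. -/
lemma norm_le_norm_parabola {p v : E3} {κ : ℝ} (hv : inner ℝ p v = 0)
    (hκ : 2 * κ * ‖p‖ ^ 2 ≤ ‖v‖ ^ 2) (t : ℝ) : ‖p‖ ≤ ‖parabola p v κ t‖ := by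
  rw [← sq_le_sq₀ (norm_nonneg _) (norm_nonneg _)]
  have h : parabola p v κ t = (1 - κ * t ^ 2) • p + t • v := by unfold parabola; module
  rw [h, norm_add_sq_real, inner_smul_left, inner_smul_right, hv, norm_smul, norm_smul, mul_pow,
    mul_pow, Real.norm_eq_abs, Real.norm_eq_abs, sq_abs, sq_abs]
  nlinarith [mul_nonneg (sq_nonneg t) (sub_nonneg.2 hκ), sq_nonneg (κ * t ^ 2 * ‖p‖)]

/-- The second derivative of a function along a parabola. -/
lemma deriv_deriv_parabola {f : E3 → ℝ} {U : Set E3} (hU : IsOpen U) (hf : ContDiffOn ℝ ∞ f U)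
    {p : E3} (hp : p ∈ U) (v : E3) (κ : ℝ) :
    deriv (fun t => f (parabola p v κ t)) 0 = ∑ i, v i * pderiv i f p ∧
    deriv (deriv (fun t => f (parabola p v κ t))) 0 =
      (∑ i, ∑ j, v i * v j * pderiv i (pderiv j f) p) - 2 * κ * ∑ i, p i * pderiv i f p := by
  have hev : ∀ᶠ t in 𝓝 (0 : ℝ), parabola p v κ t ∈ U :=
    (continuous_parabola p v κ).continuousAt.eventually_mem
      (hU.mem_nhds (by rwa [parabola_zero]))
  have hd : ∀ x ∈ U, DifferentiableAt ℝ f x := fun x hx =>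
    ((hf.contDiffAt (hU.mem_nhds hx)).differentiableAt (by simp))
  have hd2 (i : Fin 3) : DifferentiableAt ℝ (pderiv i f) p := by
    have h1 : ContDiffAt ℝ ∞ (fderiv ℝ f) p :=
      (hf.contDiffAt (hU.mem_nhds hp)).fderiv_right (m := ∞) (by simp)
    exact (h1.differentiableAt (by simp)).clm_apply (differentiableAt_const _)
  have hder : ∀ t, parabola p v κ t ∈ U → HasDerivAt (fun t => f (parabola p v κ t))
      (∑ i, (v - (2 * κ * t) • p) i * pderiv i f (parabola p v κ t)) t := fun t ht =>
    hasDerivAt_comp_curve (hd _ ht) (hasDerivAt_parabola p v κ t)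
  constructor
  · have := (hder 0 (by rwa [parabola_zero])).deriv
    simpa [parabola_zero] using this
  · have h1 : deriv (fun t => f (parabola p v κ t)) =ᶠ[𝓝 0]
        fun t => ∑ i, (v i - 2 * κ * t * p i) * pderiv i f (parabola p v κ t) := by
      filter_upwards [hev] with t ht
      simpa using (hder t ht).deriv
    rw [h1.deriv_eq]
    have h2 (i : Fin 3) : HasDerivAt
        (fun t => (v i - 2 * κ * t * p i) * pderiv i f (parabola p v κ t))
        (-(2 * κ * p i) * pderiv i f p + v i * ∑ j, v j * pderiv j (pderiv i f) p) 0 := by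
      have h3 : HasDerivAt (fun t : ℝ => v i - 2 * κ * t * p i) (-(2 * κ * p i)) 0 := by
        have := (((hasDerivAt_id (0 : ℝ)).const_mul (2 * κ)).mul_const (p i)).const_sub (v i)
        simpa using this
      have h4 := hasDerivAt_comp_curve (f := pderiv i f) (t := 0)
        (by rw [parabola_zero]; exact hd2 i) (hasDerivAt_parabola p v κ 0)
      refine (h3.mul h4).congr_deriv ?_
      simp [parabola_zero]
    rw [(HasDerivAt.fun_sum fun i _ => h2 i).deriv]
    simp only [Fin.sum_univ_three]
    ring

/-- A function whose zeros near `p` do not leave the ball of radius `‖p‖` has a constant sign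
outside of this ball. -/
lemma exists_sign_outside {f : E3 → ℝ} {U : Set E3} (hU : IsOpen U) (hf : ContinuousOn f U)
    {p : E3} (hp : p ∈ U) (hp0 : p ≠ 0) (hz : ∀ q ∈ U, f q = 0 → ‖q‖ ≤ ‖p‖) :
    ∃ σ : ℝ, σ ≠ 0 ∧ ∀ γ : ℝ → E3, Continuous γ → γ 0 = p → (∀ t, ‖p‖ ≤ ‖γ t‖) →
      ∀ᶠ t in 𝓝 (0 : ℝ), 0 ≤ σ * f (γ t) := by
  obtain ⟨δ, hδ, hball⟩ := Metric.isOpen_iff.1 hU p hp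
  have hR : 0 < ‖p‖ := norm_pos_iff.2 hp0
  obtain ⟨s₀, hs0, hs1, hsp⟩ : ∃ s₀ : ℝ, 0 < s₀ ∧ s₀ ≤ 1 ∧ s₀ * ‖p‖ < δ / 2 := by
    refine ⟨min 1 (δ / (4 * ‖p‖)), by positivity, min_le_left _ _, ?_⟩
    calc min 1 (δ / (4 * ‖p‖)) * ‖p‖ ≤ δ / (4 * ‖p‖) * ‖p‖ := by gcongr; exact min_le_right _ _
      _ = δ / 4 := by field_simp
      _ < δ / 2 := by linarith
  have hmem : ∀ s q, 0 ≤ s → s ≤ s₀ → ‖q - p‖ < δ / 4 → (1 + s) • q ∈ U := by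
    intro s q h0 h1 h2
    apply hball
    rw [mem_ball_iff_norm]
    have : (1 + s) • q - p = (1 + s) • (q - p) + s • p := by module
    rw [this]
    calc ‖(1 + s) • (q - p) + s • p‖ ≤ ‖(1 + s) • (q - p)‖ + ‖s • p‖ := norm_add_le _ _
      _ = (1 + s) * ‖q - p‖ + s * ‖p‖ := by
        rw [norm_smul, norm_smul, Real.norm_of_nonneg h0, Real.norm_of_nonneg (by linarith)]
      _ ≤ 2 * ‖q - p‖ + s₀ * ‖p‖ := by gcongr; linarith
      _ < δ := by linarith
  -- Dilating a point on or outside the sphere by 1 + s moves it strictly outside, where f has no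
  -- zeros near p.
  have hne : ∀ s q, 0 < s → s ≤ s₀ → ‖q - p‖ < δ / 4 → ‖p‖ ≤ ‖q‖ → f ((1 + s) • q) ≠ 0 := by
    intro s q h0 h1 h2 h3 h4
    have h5 := hz _ (hmem s q h0.le h1 h2) h4
    rw [norm_smul, Real.norm_of_nonneg (by linarith)] at h5
    nlinarith
  refine ⟨f ((1 + s₀) • p), hne s₀ p hs0 le_rfl (by simpa using by positivity) le_rfl, ?_⟩
  intro γ hγ hγ0 hγp
  obtain ⟨τ, hτ, hτγ⟩ : ∃ τ > 0, ∀ t, |t| < τ → ‖γ t - p‖ < δ / 4 := by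
    obtain ⟨τ, hτ, h⟩ := Metric.continuousAt_iff.1 hγ.continuousAt (δ / 4) (by positivity)
    refine ⟨τ, hτ, fun t ht => ?_⟩
    have := h (show dist t 0 < τ by simpa [Real.dist_eq] using ht)
    rwa [hγ0, dist_eq_norm] at this
  -- On this connected rectangle, which omits s = 0, the dilated curve avoids the zeros of f, so the
  -- sign is constant; letting s → 0 gives the weak inequality on the curve itself.
  set K : Set (ℝ × ℝ) := Set.Ioc 0 s₀ ×ˢ Set.Ioo (-τ) τ
  have hK : IsPreconnected K := ((convex_Ioc 0 s₀).prod (convex_Ioo (-τ) τ)).isPreconnected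
  have hcont : ContinuousOn (fun y : ℝ × ℝ => f ((1 + s₀) • p) * f ((1 + y.1) • γ y.2)) K := by
    refine continuousOn_const.mul (hf.comp (by fun_prop) ?_)
    rintro ⟨s, t⟩ ⟨⟨h1, h2⟩, h3⟩
    exact hmem s _ h1.le h2 (hτγ t (abs_lt.2 h3))
  have hbase : ((s₀, 0) : ℝ × ℝ) ∈ K := ⟨⟨hs0, le_rfl⟩, by simpa using hτ⟩
  have hpos : ∀ y ∈ K, 0 < f ((1 + s₀) • p) * f ((1 + y.1) • γ y.2) := by
    intro y hy
    by_contra! h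
    have h1 : (0 : ℝ) ∈ (fun y : ℝ × ℝ => f ((1 + s₀) • p) * f ((1 + y.1) • γ y.2)) '' K := by
      refine hK.intermediate_value hy hbase hcont ⟨h, ?_⟩
      simp only [hγ0]
      exact mul_self_nonneg _
    obtain ⟨⟨s, t⟩, ⟨⟨h2, h3⟩, h4⟩, h5⟩ := h1
    exact mul_ne_zero (hne s₀ p hs0 le_rfl (by simpa using by positivity) le_rfl)
      (hne s _ h2 h3 (hτγ t (abs_lt.2 h4)) (hγp t)) h5
  filter_upwards [Ioo_mem_nhds (neg_lt_zero.2 hτ) hτ] with t ht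
  have hlim : Tendsto (fun s : ℝ => f ((1 + s₀) • p) * f ((1 + s) • γ t)) (𝓝[>] 0)
      (𝓝 (f ((1 + s₀) • p) * f (γ t))) := by
    have h1 : γ t ∈ U := by simpa using hmem 0 (γ t) le_rfl hs0.le (hτγ t (abs_lt.2 ht))
    have h2 : ContinuousAt f ((1 + (0 : ℝ)) • γ t) := by
      simpa using hf.continuousAt (hU.mem_nhds h1)
    have h3 : ContinuousAt (fun s : ℝ => f ((1 + s) • γ t)) 0 :=
      ContinuousAt.comp (f := fun s : ℝ => (1 + s) • γ t) h2 (by fun_prop)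
    have h4 : Tendsto (fun s : ℝ => f ((1 + s) • γ t)) (𝓝[>] 0) (𝓝 (f (γ t))) := by
      simpa using h3.tendsto.mono_left nhdsWithin_le_nhds
    exact h4.const_mul _
  refine ge_of_tendsto hlim ?_
  filter_upwards [Ioc_mem_nhdsGT hs0] with s hs
  exact (hpos (s, t) ⟨hs, ht⟩).le

/-- First and second order conditions at a point where a surface touches an enclosing sphere. -/
lemma exists_touching_sign {f : E3 → ℝ} {U : Set E3} (hU : IsOpen U) (hf : ContDiffOn ℝ ∞ f U)
    {p : E3} (hp : p ∈ U) (hp0 : p ≠ 0) (hfp : f p = 0) (hz : ∀ q ∈ U, f q = 0 → ‖q‖ ≤ ‖p‖) :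
    ∃ σ : ℝ, σ ≠ 0 ∧ ∀ (v : E3) (κ : ℝ), inner ℝ p v = 0 → 2 * κ * ‖p‖ ^ 2 ≤ ‖v‖ ^ 2 →
      ∑ i, v i * pderiv i f p = 0 ∧
      0 ≤ σ * ((∑ i, ∑ j, v i * v j * pderiv i (pderiv j f) p)
        - 2 * κ * ∑ i, p i * pderiv i f p) := by
  obtain ⟨σ, hσ, h⟩ := exists_sign_outside hU hf.continuousOn hp hp0 hz
  refine ⟨σ, hσ, fun v κ hv hκ => ?_⟩
  have h1 := h (parabola p v κ) (continuous_parabola p v κ) (parabola_zero p v κ)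
    (norm_le_norm_parabola hv hκ)
  have hmin : IsLocalMin (fun t => σ * f (parabola p v κ t)) 0 := by
    filter_upwards [h1] with t ht
    simpa [parabola_zero, hfp] using ht
  have hc : ContinuousAt (fun t => σ * f (parabola p v κ t)) 0 := by
    have h2 : ContinuousAt f (parabola p v κ 0) := by
      rw [parabola_zero]; exact hf.continuousOn.continuousAt (hU.mem_nhds hp)
    exact continuousAt_const.mul
      (ContinuousAt.comp (f := parabola p v κ) h2 (continuous_parabola p v κ).continuousAt)
  obtain ⟨h3, h4⟩ := deriv_deriv_parabola hU hf hp v κ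
  have h5 := hmin.deriv_eq_zero
  have h6 := deriv_deriv_nonneg_of_isLocalMin hmin hc
  have h7 : deriv (fun t => σ * f (parabola p v κ t))
      = fun t => σ * deriv (fun t => f (parabola p v κ t)) t := by
    funext t; exact deriv_const_mul_field σ
  rw [h7] at h5 h6
  rw [deriv_const_mul_field, h4] at h6
  simp only [h3] at h5
  exact ⟨(mul_eq_zero.1 h5).resolve_left hσ, h6⟩

/-! ### The outermost minimal sphere -/

/-- If the surface `f = 0` touches the sphere of radius `‖p‖` from inside at `p`, its gradient is
radial at `p`, and its Euclidean mean curvature is at least that of the sphere. -/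
lemma touching_conditions {f : E3 → ℝ} {U : Set E3} (hU : IsOpen U) (hf : ContDiffOn ℝ ∞ f U)
    {p : E3} (hp : p ∈ U) (hp0 : p ≠ 0) (hfp : f p = 0) (hdf : fderiv ℝ f p ≠ 0)
    (hz : ∀ q ∈ U, f q = 0 → ‖q‖ ≤ ‖p‖) :
    ∃ σ D : ℝ, 0 < σ * D ∧ (∀ i, pderiv i f p = D * p i / ‖p‖ ^ 2) ∧
      2 * (σ * D) ≤ σ * (‖p‖ ^ 2 * (∑ i, pderiv i (pderiv i f) p)
        - ∑ i, ∑ j, p i * p j * pderiv i (pderiv j f) p) := by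
  obtain ⟨σ, hσ, h⟩ := exists_touching_sign hU hf hp hp0 hfp hz
  have hR : ‖p‖ ^ 2 ≠ 0 := pow_ne_zero 2 (norm_ne_zero_iff.2 hp0)
  have hRs := normSq_eq p
  set D := ∑ i, p i * pderiv i f p with hD
  -- Projections of the basis vectors to the tangent plane of the sphere; tracing over them avoids
  -- choosing an orthonormal tangent frame.
  set v : Fin 3 → E3 := fun k => EuclideanSpace.single k 1 - (p k / ‖p‖ ^ 2) • p with hv
  have hvi (k i : Fin 3) : v k i = (if i = k then 1 else 0) - p k / ‖p‖ ^ 2 * p i := by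
    simp [hv]
  have hvp (k : Fin 3) : inner ℝ p (v k) = 0 := by
    simp only [hv, inner_sub_right, inner_smul_right, real_inner_self_eq_norm_sq,
      EuclideanSpace.inner_single_right]
    simp [hR]
  have hgrad (i : Fin 3) : pderiv i f p = D * p i / ‖p‖ ^ 2 := by
    have h1 := (h (v i) 0 (hvp i) (by simp)).1
    simp only [hvi, sub_mul, Finset.sum_sub_distrib, ite_mul, one_mul, zero_mul,
      Finset.sum_ite_eq', Finset.mem_univ, if_true, mul_assoc] at h1
    rw [← Finset.mul_sum, ← hD] at h1
    linear_combination h1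
  have hD0 : D ≠ 0 := by
    intro h0
    apply hdf
    ext w
    rw [fderiv_eq_sum]
    simp [hgrad, h0]
  have hsign : 0 < σ * D := by
    -- The curve p + t²p runs radially outward and detects the sign of the radial derivative.
    have h1 := (h 0 (-1) (by simp) (by simp)).2
    simp at h1
    exact lt_of_le_of_ne (by linarith) (mul_ne_zero hσ hD0).symm
  refine ⟨σ, D, hsign, hgrad, ?_⟩
  have hnorm (k : Fin 3) : ‖v k‖ ^ 2 = 1 - p k ^ 2 / ‖p‖ ^ 2 := by
    rw [← real_inner_self_eq_norm_sq, hv]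
    simp only [inner_sub_left, inner_sub_right, inner_smul_left, inner_smul_right,
      real_inner_self_eq_norm_sq, EuclideanSpace.inner_single_right,
      EuclideanSpace.inner_single_left]
    simp
    field_simp
    ring
  have hk (k : Fin 3) := (h (v k) (‖v k‖ ^ 2 / (2 * ‖p‖ ^ 2)) (hvp k) (by field_simp; rfl)).2
  have hsum := add_nonneg (add_nonneg (hk 0) (hk 1)) (hk 2)
  -- The sum of the v_k ⊗ v_k is the tangential projection, and the sum of the ‖v_k‖² is its trace
  -- 2.
  have hid : ‖p‖ ^ 2 * (∑ k, ((∑ i, ∑ j, v k i * v k j * pderiv i (pderiv j f) p)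
        - 2 * (‖v k‖ ^ 2 / (2 * ‖p‖ ^ 2)) * D)) =
      ‖p‖ ^ 2 * (∑ i, pderiv i (pderiv i f) p)
        - (∑ i, ∑ j, p i * p j * pderiv i (pderiv j f) p) - 2 * D := by
    simp only [hnorm, hvi, Fin.sum_univ_three]
    rw [hRs] at hR ⊢
    simp
    field_simp
    ring
  have h9 : 0 ≤ ‖p‖ ^ 2 * (σ * ∑ k, ((∑ i, ∑ j, v k i * v k j * pderiv i (pderiv j f) p)
        - 2 * (‖v k‖ ^ 2 / (2 * ‖p‖ ^ 2)) * D)) := by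
    apply mul_nonneg (by positivity)
    rw [Fin.sum_univ_three (f := fun k => (∑ i, ∑ j, v k i * v k j * pderiv i (pderiv j f) p)
        - 2 * (‖v k‖ ^ 2 / (2 * ‖p‖ ^ 2)) * D)]
    linarith
  rw [mul_left_comm, hid] at h9
  linarith

namespace Profile

variable (P : Profile)

/-- The conformally flat metric of a profile. -/
def metric : Metric E3 := confMetric P.factor P.contDiff_factor P.factor_ne_zero

/-- The conformal term involves only the normal derivative of u, which at the contact point is the
same for the surface and the sphere. The Euclidean comparison thus carries over, and H = 0 would
give σD·`sphereCurv` ≤ 0. -/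
lemma meanCurvature_ne_zero {f : E3 → ℝ} {U : Set E3} (hU : IsOpen U) (hf : ContDiffOn ℝ ∞ f U)
    {p : E3} (hp : p ∈ U) (hp0 : p ≠ 0) (hfp : f p = 0) (hdf : fderiv ℝ f p ≠ 0)
    (hz : ∀ q ∈ U, f q = 0 → ‖q‖ ≤ ‖p‖) (hc : 0 < P.sphereCurv (‖p‖ ^ 2)) :
    meanCurvature P.metric f p ≠ 0 := by
  obtain ⟨σ, D, hσD, hgrad, hhess⟩ := touching_conditions hU hf hp hp0 hfp hdf hz
  have hR : 0 < ‖p‖ ^ 2 := pow_pos (norm_pos_iff.2 hp0) 2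
  have hD : D ≠ 0 := by rintro rfl; simp at hσD
  have hu := P.factor_pos p
  have hg : ∑ i, pderiv i f p ^ 2 = D ^ 2 / ‖p‖ ^ 2 := by
    simp only [hgrad, Fin.sum_univ_three]
    have h1 := normSq_eq p
    field_simp
    rw [h1]
  have hg0 : ∑ i, pderiv i f p ^ 2 ≠ 0 := by rw [hg]; positivity
  have h1 : (∑ i, ∑ j, pderiv i f p * pderiv j f p * pderiv i (pderiv j f) p)
      / (∑ i, pderiv i f p ^ 2)
      = (∑ i, ∑ j, p i * p j * pderiv i (pderiv j f) p) / ‖p‖ ^ 2 := by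
    rw [hg]
    simp only [hgrad, Fin.sum_univ_three]
    field_simp
  have h2 : ∑ i, pderiv i P.factor p * pderiv i f p = -(P.slope (‖p‖ ^ 2) * D) := by
    have h3 := normSq_eq p
    simp only [hgrad, P.pderiv_factor, Fin.sum_univ_three]
    field_simp
    rw [h3]; ring
  rw [metric, meanCurvature_confMetric,
    coordMeanCurvature_conf P.contDiff_factor P.factor_ne_zero f p hg0, h1, h2]
  have hgs : 0 < coordGradSq (conf P.factor) f p := by
    have : coordGradSq (conf P.factor) f p
        = (P.factor p ^ 4)⁻¹ * ∑ i, pderiv i f p ^ 2 := by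
      simp [coordGradSq, conf_inv (P.factor_ne_zero p), ite_mul, Finset.mul_sum, sq, mul_assoc]
    rw [this, hg]; positivity
  refine div_ne_zero ?_ (mul_ne_zero (by positivity) (Real.sqrt_pos.2 hgs).ne')
  intro h0
  have h3 : σ * (‖p‖ ^ 2 * (∑ i, pderiv i (pderiv i f) p)
      - ∑ i, ∑ j, p i * p j * pderiv i (pderiv j f) p)
      = 4 * ‖p‖ ^ 2 * P.slope (‖p‖ ^ 2) * (σ * D) / P.factor p := by
    field_simp at h0 ⊢
    linear_combination σ * h0
  rw [h3, le_div_iff₀ hu] at hhess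
  have h4 : P.sphereCurv (‖p‖ ^ 2) = P.factor p - 2 * ‖p‖ ^ 2 * P.slope (‖p‖ ^ 2) := rfl
  rw [h4] at hc
  nlinarith

lemma pderiv_normSq_sub (c : ℝ) (i : Fin 3) :
    pderiv i (fun y : E3 => ‖y‖ ^ 2 - c) = fun x => 2 * x i := by
  funext x
  have hd : DifferentiableAt ℝ (fun y : E3 => ‖y‖ ^ 2) x :=
    ((contDiff_norm_sq ℝ (n := ∞)).differentiable (by simp)) x
  rw [pderiv_sub hd (differentiableAt_const _), pderiv_normSq, pderiv_const, sub_zero]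

lemma isClosedMinimalSurface_sphere {ρ : ℝ} (hρ : 0 < ρ) (hc : P.sphereCurv (ρ ^ 2) = 0) :
    IsClosedMinimalSurface P.metric (Metric.sphere (0 : E3) ρ) := by
  refine ⟨isCompact_sphere 0 ρ, fun p hp => ?_⟩
  have hpρ : ‖p‖ = ρ := mem_sphere_zero_iff_norm.1 hp
  have hd (i j : Fin 3) : pderiv i (pderiv j (fun y : E3 => ‖y‖ ^ 2 - ρ ^ 2)) p
      = if j = i then 2 else 0 := by
    rw [pderiv_normSq_sub, pderiv_const_mul _ (by fun_prop), pderiv_coord]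
    split_ifs <;> norm_num
  have hn := normSq_eq p
  rw [hpρ] at hn
  refine ⟨fun y => ‖y‖ ^ 2 - ρ ^ 2, ⟨?_, Set.univ, isOpen_univ, Set.mem_univ p, ?_, ?_⟩, ?_⟩
  · rw [mfderiv_eq_fderiv]
    intro h0
    have h1 : ∑ i, p i * pderiv i (fun y : E3 => ‖y‖ ^ 2 - ρ ^ 2) p = 0 := by
      rw [← fderiv_eq_sum]
      exact congrArg (fun A : E3 →L[ℝ] ℝ => A p) h0
    simp only [pderiv_normSq_sub, Fin.sum_univ_three] at h1
    nlinarith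
  · exact ((contDiff_norm_sq ℝ).sub contDiff_const).contMDiff.contMDiffOn
  · intro q _
    rw [mem_sphere_zero_iff_norm, sub_eq_zero, sq_eq_sq₀ (norm_nonneg _) hρ.le]
  · have hu := P.factor_pos p
    have hg : ∑ i, pderiv i (fun y : E3 => ‖y‖ ^ 2 - ρ ^ 2) p ^ 2 = 4 * ρ ^ 2 := by
      simp only [pderiv_normSq_sub, Fin.sum_univ_three]
      rw [hn]; ring
    rw [metric, meanCurvature_confMetric,
      coordMeanCurvature_conf P.contDiff_factor P.factor_ne_zero _ p (by rw [hg]; positivity), hg]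
    apply div_eq_zero_iff.2
    left
    simp only [hd]
    simp only [pderiv_normSq_sub, P.pderiv_factor, hpρ]
    have h4 : P.sphereCurv (ρ ^ 2) = P.factor p - 2 * ρ ^ 2 * P.slope (ρ ^ 2) := by
      rw [← hpρ]; rfl
    rw [h4] at hc
    simp [Fin.sum_univ_three]
    field_simp
    rw [hn] at hc ⊢
    linear_combination (16 * (p 0 ^ 2 + p 1 ^ 2 + p 2 ^ 2)) * hc

end Profile

/-! ### Exterior of a coordinate sphere and outermostness -/

lemma one_lt_rank_E3 : 1 < Module.rank ℝ E3 := by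
  rw [← Module.finrank_eq_rank, finrank_euclideanSpace]
  simp

lemma isConnected_setOf_lt_norm {ρ : ℝ} (hρ : 0 ≤ ρ) : IsConnected {x : E3 | ρ < ‖x‖} := by
  have h1 : IsConnected (Set.Ioi ρ ×ˢ Metric.sphere (0 : E3) 1) :=
    isConnected_Ioi.prod (isConnected_sphere one_lt_rank_E3 0 zero_le_one)
  have h2 : {x : E3 | ρ < ‖x‖} = (fun y : ℝ × E3 => y.1 • y.2) ''
      (Set.Ioi ρ ×ˢ Metric.sphere (0 : E3) 1) := by
    ext x
    constructor
    · intro (hx : ρ < ‖x‖)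
      have hx0 : ‖x‖ ≠ 0 := by linarith
      refine ⟨(‖x‖, ‖x‖⁻¹ • x), ⟨hx, ?_⟩, ?_⟩
      · simp [norm_smul, hx0]
      · simp [smul_smul, hx0]
    · rintro ⟨⟨r, y⟩, ⟨hr, hy⟩, rfl⟩
      have hr' : ρ < r := hr
      have hy' : ‖y‖ = 1 := mem_sphere_zero_iff_norm.1 hy
      simp only [Set.mem_ofPred_eq, norm_smul, hy', mul_one, Real.norm_eq_abs]
      exact hr'.trans_le (le_abs_self r)
  rw [h2]
  exact h1.image _ (by fun_prop)

lemma standardEnd_exterior_sphere {ρ : ℝ} (hρ : 0 < ρ) :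
    standardEnd.exterior (Metric.sphere (0 : E3) ρ) = {x : E3 | ρ < ‖x‖} := by
  ext p
  constructor
  · rintro ⟨C, hC, hCS, hpC, R, -, hR⟩
    by_contra! hp
    have hp' : ‖p‖ ≤ ρ := not_lt.1 hp
    obtain ⟨q, hq⟩ : ∃ q : E3, max R ρ < ‖q‖ := by
      refine ⟨EuclideanSpace.single 0 (|max R ρ| + 1), ?_⟩
      rw [PiLp.norm_single, Real.norm_of_nonneg (by positivity)]
      linarith [le_abs_self (max R ρ)]
    have hqC : q ∈ C := hR ⟨q, (le_max_left _ _).trans_lt hq, rfl⟩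
    obtain ⟨y, hy, hyρ⟩ := hC.isPreconnected.intermediate_value hpC hqC
      continuous_norm.continuousOn ⟨hp', ((le_max_right R ρ).trans_lt hq).le⟩
    exact hCS hy (mem_sphere_zero_iff_norm.2 hyρ)
  · intro (hp : ρ < ‖p‖)
    refine ⟨{x : E3 | ρ < ‖x‖}, isConnected_setOf_lt_norm hρ.le, ?_, hp, max 1 ρ,
      le_max_left _ _, ?_⟩
    · intro x (hx : ρ < ‖x‖) hxS
      exact hx.ne' (mem_sphere_zero_iff_norm.1 hxS)
    · rintro _ ⟨x, hx, rfl⟩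
      have hx' : max 1 ρ < ‖x‖ := hx
      exact (le_max_right _ _).trans_lt hx'

lemma frontier_closure_setOf_lt_norm {ρ : ℝ} (hρ : 0 < ρ) :
    frontier (closure {x : E3 | ρ < ‖x‖}) = Metric.sphere (0 : E3) ρ := by
  have h1 : {x : E3 | ρ < ‖x‖} = (Metric.closedBall (0 : E3) ρ)ᶜ := by ext; simp
  have h2 : closure {x : E3 | ρ < ‖x‖} = (Metric.ball (0 : E3) ρ)ᶜ := by
    rw [h1, closure_compl, interior_closedBall _ hρ.ne']
  rw [h2, frontier_compl, frontier_ball _ hρ.ne']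

/-- The coordinate sphere of radius `ρ` is the outermost minimal surface if it is minimal and all
larger spheres are mean convex. -/
theorem Profile.isOutermostMinimalSurface_sphere (P : Profile) {ρ : ℝ} (hρ : 0 < ρ)
    (hc : P.sphereCurv (ρ ^ 2) = 0) (hc' : ∀ r > ρ, 0 < P.sphereCurv (r ^ 2)) :
    IsOutermostMinimalSurface P.metric standardEnd (Metric.sphere (0 : E3) ρ) := by
  refine ⟨P.isClosedMinimalSurface_sphere hρ hc, ?_, ?_⟩
  · rw [standardEnd_exterior_sphere hρ, frontier_closure_setOf_lt_norm hρ]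
  · rintro S ⟨hS, hmin⟩
    rw [standardEnd_exterior_sphere hρ, Set.disjoint_left]
    intro q hqS (hq : ρ < ‖q‖)
    -- At a farthest point the surface touches, from inside, the sphere through that point.
    obtain ⟨p, hpS, hmax⟩ := hS.exists_isMaxOn ⟨q, hqS⟩ continuous_norm.continuousOn
    have hp : ρ < ‖p‖ := hq.trans_le (hmax hqS)
    obtain ⟨f, ⟨hdf, U, hU, hpU, hf, hSf⟩, hH⟩ := hmin p hpS
    rw [mfderiv_eq_fderiv] at hdf
    exact P.meanCurvature_ne_zero hU hf.contDiffOn hpU (norm_pos_iff.1 (hρ.trans hp))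
      ((hSf p hpU).1 hpS) hdf (fun y hy hy0 => hmax ((hSf y hy).2 hy0)) (hc' _ hp) hH

/-- Spheres of positive radius are homeomorphic to the unit sphere. -/
lemma nonempty_homeomorph_sphere {ρ : ℝ} (hρ : 0 < ρ) :
    Nonempty (Metric.sphere (0 : E3) ρ ≃ₜ Metric.sphere (0 : E3) 1) := by
  refine ⟨(Homeomorph.smulOfNeZero ρ⁻¹ (inv_ne_zero hρ.ne')).sets ?_⟩
  ext x
  simp only [mem_sphere_zero_iff_norm, Set.mem_preimage, Homeomorph.smulOfNeZero_apply, norm_smul,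
    norm_inv, Real.norm_of_nonneg hρ.le]
  rw [inv_mul_eq_one₀ hρ.ne', eq_comm]

/-! ### Decay at infinity -/

/-- `f = O(|x|ⁿ)` as `|x| → ∞`. -/
def Decays (f : E3 → ℝ) (n : ℤ) : Prop := f =O[Bornology.cobounded E3] fun x => ‖x‖ ^ n

lemma eventually_one_le_norm : ∀ᶠ x in Bornology.cobounded E3, 1 ≤ ‖x‖ :=
  tendsto_norm_cobounded_atTop.eventually_ge_atTop 1

namespace Decays

variable {f h : E3 → ℝ} {n k : ℤ}

lemma mul (hf : Decays f n) (hh : Decays h k) : Decays (fun x => f x * h x) (n + k) := by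
  refine (Asymptotics.IsBigO.mul hf hh).congr' EventuallyEq.rfl ?_
  filter_upwards [eventually_one_le_norm] with x hx
  rw [zpow_add₀ (by linarith)]

lemma add (hf : Decays f n) (hh : Decays h n) : Decays (fun x => f x + h x) n :=
  Asymptotics.IsBigO.add hf hh

lemma sub (hf : Decays f n) (hh : Decays h n) : Decays (fun x => f x - h x) n :=
  Asymptotics.IsBigO.sub hf hh

lemma neg (hf : Decays f n) : Decays (fun x => -f x) n := Asymptotics.IsBigO.neg_left hf

lemma const_mul (hf : Decays f n) (c : ℝ) : Decays (fun x => c * f x) n :=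
  Asymptotics.IsBigO.const_mul_left hf c

lemma mono (hf : Decays f n) (hnk : n ≤ k) : Decays f k := by
  refine Asymptotics.IsBigO.trans hf (Asymptotics.IsBigO.of_bound 1 ?_)
  filter_upwards [eventually_one_le_norm] with x hx
  rw [one_mul, norm_zpow, norm_zpow, norm_norm]
  exact zpow_le_zpow_right₀ hx hnk

lemma of_bounded {C : ℝ} (hf : ∀ x, |f x| ≤ C) : Decays f 0 :=
  Asymptotics.IsBigO.of_bound C (Eventually.of_forall fun x => by simpa using hf x)

lemma const (c : ℝ) : Decays (fun _ => c) 0 := of_bounded fun _ => le_rfl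

lemma zero (n : ℤ) : Decays (fun _ => 0) n := Asymptotics.isBigO_zero _ _

lemma pow (hf : Decays f n) (j : ℕ) : Decays (fun x => f x ^ j) (j * n) := by
  induction j with
  | zero => simpa using const 1
  | succ j ih =>
    have := ih.mul hf
    simp only [← pow_succ] at this
    convert this using 1
    push_cast; ring

lemma coord (i : Fin 3) : Decays (fun x => x i) 1 :=
  Asymptotics.IsBigO.of_bound 1 (Eventually.of_forall fun x => by
    simpa using PiLp.norm_apply_le x i)

lemma softInv {κ : ℝ} (hκ : 0 < κ) : Decays (fun x => softInv κ (‖x‖ ^ 2)) (-1) := by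
  refine Asymptotics.IsBigO.of_bound 1 ?_
  filter_upwards [eventually_one_le_norm] with x hx
  have h1 : ‖x‖ ≤ √(‖x‖ ^ 2 + κ) := Real.le_sqrt_of_sq_le (by linarith)
  rw [one_mul, Real.norm_of_nonneg (softInv_pos hκ (by positivity)).le, zpow_neg_one, norm_inv,
    norm_norm]
  exact inv_anti₀ (by linarith) h1

lemma ite (hf : Decays f n) (p : Prop) [Decidable p] :
    Decays (fun x => if p then f x else 0) n := by
  split_ifs
  · exact hf
  · exact zero n

end Decays

namespace Profile

variable (P : Profile)

lemma decays_factor_sub_one : Decays (fun x => P.factor x - 1) (-1) := by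
  have h1 := Decays.softInv P.e_pos
  have h2 := Decays.softInv P.L_pos
  have h3 : (fun x => P.factor x - 1) = fun x : E3 => P.a * softInv P.e (‖x‖ ^ 2)
      + P.b * softInv P.L (‖x‖ ^ 2) - P.c * softInv P.L (‖x‖ ^ 2) ^ 2 := by
    funext x; simp only [factor, val]; ring
  rw [h3]
  exact ((h1.const_mul _).add (h2.const_mul _)).sub
    (((h2.pow 2).const_mul _).mono (by norm_num))

lemma decays_factor : Decays P.factor 0 := by
  have := (P.decays_factor_sub_one.mono (by norm_num : (-1 : ℤ) ≤ 0)).add (Decays.const 1)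
  simpa using this

lemma decays_inv_factor : Decays (fun x => (P.factor x)⁻¹) 0 :=
  Decays.of_bounded (C := 1) fun x => by
    rw [abs_of_pos (inv_pos.2 (P.factor_pos x))]
    exact inv_le_one_of_one_le₀ (P.one_le_factor x)

lemma decays_slope : Decays (fun x => P.slope (‖x‖ ^ 2)) (-3) := by
  have h1 := Decays.softInv P.e_pos
  have h2 := Decays.softInv P.L_pos
  exact (((h1.pow 3).const_mul _).add ((h2.pow 3).const_mul _)).sub
    (((h2.pow 4).const_mul _).mono (by norm_num))

lemma decays_bend : Decays (fun x => P.bend (‖x‖ ^ 2)) (-5) := by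
  have h1 := Decays.softInv P.e_pos
  have h2 := Decays.softInv P.L_pos
  exact (((h1.pow 5).const_mul _).add ((h2.pow 5).const_mul _)).sub
    (((h2.pow 6).const_mul _).mono (by norm_num))

lemma decays_pderiv_factor (i : Fin 3) : Decays (pderiv i P.factor) (-2) := by
  rw [pderiv_factor]
  exact ((Decays.coord i).mul P.decays_slope).neg

lemma decays_pderiv_pderiv_factor (i j : Fin 3) : Decays (pderiv j (pderiv i P.factor)) (-3) := by
  have h : pderiv j (pderiv i P.factor) = fun x => x i * x j * P.bend (‖x‖ ^ 2)
      - if i = j then P.slope (‖x‖ ^ 2) else 0 := by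
    funext x; exact P.pderiv_pderiv_factor i j x
  rw [h]
  exact (((Decays.coord i).mul (Decays.coord j)).mul P.decays_bend).sub (P.decays_slope.ite _)

lemma isAsymptoticallyFlat : IsAsymptoticallyFlat P.metric standardEnd := by
  intro i j
  have hu := P.decays_factor
  have hfirst (l : Fin 3) : pderiv l (fun x => conf P.factor x i j) = fun x =>
      if i = j then 4 * (P.factor x ^ 3 * pderiv l P.factor x) else 0 := by
    funext x; rw [pderiv_conf P.contDiff_factor, mul_assoc]
  rw [metric, standardEnd_metric]
  refine ⟨?_, fun k => ?_, fun k l => ?_⟩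
  · have h : (fun x => conf P.factor x i j - (1 : Matrix (Fin 3) (Fin 3) ℝ) i j) = fun x =>
        if i = j then (P.factor x - 1) * (P.factor x ^ 3 + P.factor x ^ 2 + P.factor x + 1)
          else 0 := by
      funext x
      rw [conf_apply, Matrix.one_apply]
      split_ifs <;> ring
    rw [h]
    have h1 : Decays (fun x => P.factor x ^ 3 + P.factor x ^ 2 + P.factor x + 1) 0 :=
      (((hu.pow 3).add (hu.pow 2)).add hu).add (Decays.const 1)
    exact (P.decays_factor_sub_one.mul h1).ite _
  · rw [hfirst]
    exact (((hu.pow 3).mul (P.decays_pderiv_factor k)).const_mul 4).ite _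
  · have h : pderiv k (pderiv l fun x => conf P.factor x i j) = fun x => if i = j then
        4 * (3 * (P.factor x ^ 2 * pderiv k P.factor x * pderiv l P.factor x)
          + P.factor x ^ 3 * pderiv k (pderiv l P.factor) x) else 0 := by
      funext x
      have h1 := P.contDiff_factor.differentiable (by simp) x
      have h2 := (contDiff_pderiv P.contDiff_factor l).differentiable (by simp) x
      rw [hfirst, pderiv_ite, pderiv_const_mul _ (by fun_prop), pderiv_mul (by fun_prop) h2,
        pderiv_pow 3 h1]
      push_cast
      simp only [mul_assoc]
    rw [h]
    exact ((((((hu.pow 2).mul (P.decays_pderiv_factor k)).mul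
      (P.decays_pderiv_factor l)).const_mul 3).mono (by norm_num)).add
      ((hu.pow 3).mul (P.decays_pderiv_pderiv_factor l k)) |>.const_mul 4).ite _

/-! ### The electric field -/

/-- The electric field `Q u⁻⁵ (r² + L)^(-3/2) x`. -/
def fieldFun (Q : ℝ) (x : E3) : E3 := (Q * softInv P.L (‖x‖ ^ 2) ^ 3 / P.factor x ^ 5) • x

lemma contDiff_fieldFun (Q : ℝ) : ContDiff ℝ ∞ (P.fieldFun Q) :=
  ((contDiff_const.mul ((contDiff_softInv P.L_pos).pow 3)).div (P.contDiff_factor.pow 5)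
    fun x => pow_ne_zero 5 (P.factor_ne_zero x)).smul contDiff_id

/-- The electric field of a profile with total charge `Q`. -/
def electricField (Q : ℝ) : VField E3 := vfield (P.fieldFun Q) (P.contDiff_fieldFun Q)

lemma fieldFun_apply (Q : ℝ) (i : Fin 3) (x : E3) :
    P.fieldFun Q x i = Q * (softInv P.L (‖x‖ ^ 2) ^ 3 * x i) / P.factor x ^ 5 := by
  simp only [fieldFun, PiLp.smul_apply, smul_eq_mul]; ring

lemma fieldDecays (Q : ℝ) : FieldDecays (P.electricField Q) standardEnd := by
  intro i
  have h1 := Decays.softInv P.L_pos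
  have hd := (contDiff_softInv P.L_pos).differentiable (by simp)
  rw [electricField, standardEnd_field]
  simp only [fieldFun_apply]
  have hnum : Decays (fun x => Q * (softInv P.L (‖x‖ ^ 2) ^ 3 * x i)) (-2) :=
    ((h1.pow 3).mul (Decays.coord i)).const_mul Q
  refine ⟨?_, fun k => ?_⟩
  · have := hnum.mul (P.decays_inv_factor.pow 5)
    simp only [inv_pow, ← div_eq_mul_inv] at this
    exact this
  · have hpn (x : E3) : pderiv k (fun x : E3 => Q * (softInv P.L (‖x‖ ^ 2) ^ 3 * x i)) x =
        Q * (softInv P.L (‖x‖ ^ 2) ^ 3 * (if i = k then 1 else 0)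
          - 3 * (softInv P.L (‖x‖ ^ 2) ^ 5 * x k * x i)) := by
      have hdx := hd x
      rw [pderiv_const_mul _ (by fun_prop), pderiv_mul (by fun_prop) (by fun_prop), pderiv_coord,
        pderiv_pow 3 hdx, pderiv_softInv P.L_pos]
      push_cast
      ring
    have h : pderiv k (fun x : E3 => Q * (softInv P.L (‖x‖ ^ 2) ^ 3 * x i) / P.factor x ^ 5) =
        fun x => Q * (softInv P.L (‖x‖ ^ 2) ^ 3 * (if i = k then 1 else 0)
          - 3 * (softInv P.L (‖x‖ ^ 2) ^ 5 * x k * x i)) * (P.factor x)⁻¹ ^ 5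
          - 5 * (Q * (softInv P.L (‖x‖ ^ 2) ^ 3 * x i) * pderiv k P.factor x
            * (P.factor x)⁻¹ ^ 6) := by
      funext x
      have hdx := hd x
      have hu := P.contDiff_factor.differentiable (by simp) x
      have hu0 := P.factor_ne_zero x
      rw [pderiv_div (by fun_prop) (by fun_prop) (pow_ne_zero 5 hu0), hpn, pderiv_pow 5 hu]
      push_cast
      field_simp
    rw [h]
    have h2 : Decays (fun x => Q * (softInv P.L (‖x‖ ^ 2) ^ 3 * (if i = k then 1 else 0)
          - 3 * (softInv P.L (‖x‖ ^ 2) ^ 5 * x k * x i))) (-3) :=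
      (((h1.pow 3).mul (Decays.const _)).sub ((((h1.pow 5).mul (Decays.coord k)).mul
        (Decays.coord i)).const_mul 3)).const_mul Q
    exact (h2.mul (P.decays_inv_factor.pow 5)).sub
      ((((hnum.mul (P.decays_pderiv_factor k)).mul (P.decays_inv_factor.pow 6)).const_mul 5).mono
        (by norm_num))

/-- With w = (r²+L)^(-1/2), the squared g-norm of E is Q²w⁶r²u⁻⁶. It is at most Q²w⁴u⁻⁵, since w²r²
≤ 1 and u ≥ 1. -/
lemma chargedDEC {Q : ℝ} (hQ : Q ^ 2 ≤ 8 * P.c) : ChargedDEC P.metric (P.electricField Q) := by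
  intro x
  rw [metric, scalarCurvature_confMetric]
  refine le_trans ?_ (P.scalarCurvature_factor_ge x)
  have hu := P.one_le_factor x
  have hu0 := P.factor_pos x
  have hw := softInv_pos P.L_pos (t := ‖x‖ ^ 2) (by positivity)
  have hw2 := softInv_sq P.L_pos (t := ‖x‖ ^ 2) (by positivity)
  have hL := P.L_pos
  change 2 * (P.factor x ^ 4 * inner ℝ (P.fieldFun Q x) (P.fieldFun Q x)) ≤ _
  rw [fieldFun, inner_smul_left, inner_smul_right, real_inner_self_eq_norm_sq, conj_trivial]
  set w := softInv P.L (‖x‖ ^ 2)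
  set u := P.factor x
  have h1 : w ^ 2 * ‖x‖ ^ 2 ≤ 1 := by nlinarith [mul_pos (pow_pos hw 2) hL]
  calc 2 * (u ^ 4 * (Q * w ^ 3 / u ^ 5 * (Q * w ^ 3 / u ^ 5 * ‖x‖ ^ 2)))
      = 2 * Q ^ 2 * w ^ 4 * (w ^ 2 * ‖x‖ ^ 2) / u ^ 6 := by field_simp
    _ ≤ 2 * (8 * P.c) * w ^ 4 * 1 / u ^ 5 := by
        have := P.c_nonneg
        gcongr ?_ / ?_
        · gcongr
        · exact pow_le_pow_right₀ hu (by norm_num)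
    _ = 16 * P.c * w ^ 4 / u ^ 5 := by ring

end Profile

/-! ### Mass and charge -/

lemma sphereIntegral_of_radial {F : E3 → ℝ} {R c : ℝ} (hR : 0 < R) (hF : ∀ x, ‖x‖ = R → F x = c) :
    sphereIntegral F R = 4 * Real.pi * R ^ 2 * c := by
  have h : ∀ u : Metric.sphere (0 : E3) 1, F (R • (u : E3)) = c := fun u => by
    apply hF
    rw [norm_smul, norm_eq_of_mem_sphere, Real.norm_of_nonneg hR.le, mul_one]
  simp only [sphereIntegral, h, integral_const, smul_eq_mul]
  rw [Measure.toSphere_real_apply_univ, measureReal_def, EuclideanSpace.volume_ball_fin_three]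
  simp only [finrank_euclideanSpace, Fintype.card_fin, ENNReal.ofReal_one, one_pow, one_mul]
  rw [ENNReal.toReal_ofReal (by positivity)]
  push_cast
  ring

lemma tendsto_mul_softInv (κ : ℝ) : Tendsto (fun R : ℝ => R * softInv κ (R ^ 2)) atTop (𝓝 1) := by
  have h1 : Tendsto (fun R : ℝ => (√(1 + κ * (R⁻¹) ^ 2))⁻¹) atTop (𝓝 1) := by
    have h2 : Tendsto (fun R : ℝ => 1 + κ * (R⁻¹) ^ 2) atTop (𝓝 1) := by
      simpa using ((tendsto_inv_atTop_zero (𝕜 := ℝ)).pow 2 |>.const_mul κ).const_add 1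
    simpa using h2.sqrt.inv₀ (by simp)
  refine h1.congr' ?_
  filter_upwards [eventually_gt_atTop 0] with R hR
  have h3 : R ^ 2 + κ = R ^ 2 * (1 + κ * (R⁻¹) ^ 2) := by field_simp
  rw [softInv, h3, Real.sqrt_mul (by positivity), Real.sqrt_sq hR.le]
  field_simp

lemma tendsto_softInv (κ : ℝ) : Tendsto (fun R : ℝ => softInv κ (R ^ 2)) atTop (𝓝 0) := by
  have h := (tendsto_mul_softInv κ).mul (tendsto_inv_atTop_zero (𝕜 := ℝ))
  rw [mul_zero] at h
  refine h.congr' ?_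
  filter_upwards [eventually_gt_atTop 0] with R hR
  field_simp

namespace Profile

variable (P : Profile)

lemma tendsto_val : Tendsto (fun R : ℝ => P.val (R ^ 2)) atTop (𝓝 1) := by
  have h1 := tendsto_softInv P.e
  have h2 := tendsto_softInv P.L
  have := (((h1.const_mul P.a).const_add 1).add (h2.const_mul P.b)).sub ((h2.pow 2).const_mul P.c)
  simpa [val] using this

lemma tendsto_slope : Tendsto (fun R : ℝ => R ^ 3 * P.slope (R ^ 2)) atTop (𝓝 (P.a + P.b)) := by
  have h1 := tendsto_mul_softInv P.e
  have h2 := tendsto_mul_softInv P.L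
  have h3 := tendsto_softInv P.L
  have := (((h1.pow 3).const_mul P.a).add ((h2.pow 3).const_mul P.b)).sub
    (((h2.pow 3).mul h3).const_mul (2 * P.c))
  simp only [one_pow, mul_one, mul_zero, sub_zero] at this
  refine this.congr fun R => ?_
  unfold slope
  ring

/-- For u⁴δ the flux density is the radial derivative of -2u⁴, namely 8u³ times r times the slope,
and r³ times the slope tends to a + b. -/
lemma hasADMMass : HasADMMass P.metric standardEnd (2 * (P.a + P.b)) := by
  have h := (((P.tendsto_val.pow 3).mul P.tendsto_slope).const_mul 2)
  rw [one_pow, one_mul] at h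
  refine h.congr' ?_
  filter_upwards [eventually_gt_atTop 0] with R hR
  rw [sphereIntegral_of_radial (c := 8 * P.val (R ^ 2) ^ 3 * P.slope (R ^ 2) * R) hR]
  · field_simp
    ring
  · intro x hx
    have hn := normSq_eq x
    have hu : P.factor x = P.val (R ^ 2) := by rw [← hx]; rfl
    simp only [metric, standardEnd_metric, pderiv_conf P.contDiff_factor, P.pderiv_factor,
      Fin.sum_univ_three, hu]
    rw [hx] at hn ⊢
    simp
    field_simp
    rw [hn]
    ring

/-- The volume factor u⁶ against u⁻⁵ in the field leaves a single u, which tends to 1. -/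
lemma hasTotalCharge (Q : ℝ) : HasTotalCharge P.metric (P.electricField Q) standardEnd Q := by
  have h := ((P.tendsto_val.mul ((tendsto_mul_softInv P.L).pow 3)).const_mul Q)
  rw [one_pow, one_mul, mul_one] at h
  refine h.congr' ?_
  filter_upwards [eventually_gt_atTop 0] with R hR
  rw [sphereIntegral_of_radial (c := Q * P.val (R ^ 2) * softInv P.L (R ^ 2) ^ 3 * R) hR]
  · field_simp
  · intro x hx
    have hn := normSq_eq x
    have hu : P.factor x = P.val (R ^ 2) := by rw [← hx]; rfl
    have hu0 := P.factor_pos x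
    have hdet : Real.sqrt (conf P.factor x).det = P.factor x ^ 6 := by
      rw [conf, Matrix.det_smul, Matrix.det_one, Fintype.card_fin, mul_one, ← pow_mul,
        show 4 * 3 = 6 * 2 from rfl, pow_mul, Real.sqrt_sq (by positivity)]
    simp only [metric, standardEnd_metric, hdet, electricField, standardEnd_field, fieldFun_apply,
      Fin.sum_univ_three, hx]
    rw [hu] at hu0 ⊢
    rw [hx] at hn
    field_simp
    rw [hn]
    ring

end Profile

end ChargedAF

end

theorem theorem3p4 (A Q m : ℝ) (hA : 0 < A) (hQ : 0 < Q)
    (hm : Real.sqrt (A / (16 * Real.pi)) < m) :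
    ∃ (M : Type) (_ : TopologicalSpace M) (_ : ChartedSpace ChargedAF.E3 M) (_ : IsManifold (𝓡 3) ∞ M)
      (_ : T2Space M) (_ : SecondCountableTopology M) (_ : ConnectedSpace M)
      (g : ChargedAF.Metric M) (E : ChargedAF.VField M) (e : ChargedAF.End M),
      ChargedAF.IsChargedAF g E e ∧
      ChargedAF.ChargedDEC g E ∧
      ChargedAF.HasADMMass g e m ∧
      ChargedAF.HasTotalCharge g E e Q ∧
      ∃ S : Set M, ChargedAF.IsOutermostMinimalSurface g e S ∧ ChargedAF.HasArea g S A ∧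
        Nonempty (S ≃ₜ Metric.sphere (0 : ChargedAF.E3) 1) := by
  have hpi := Real.pi_pos
  have hAμ : A = 16 * Real.pi * Real.sqrt (A / (16 * Real.pi)) ^ 2 := by
    rw [Real.sq_sqrt (by positivity)]; field_simp
  -- With μ = √(A/16π), the relation ρu² = 2μ squares to the area identity 4πρ²u⁴ = A.
  obtain ⟨P, ρ, hρ, hPQ, hPm, hc, hc', hval⟩ := ChargedAF.exists_profile (Q := Q)
    (show 0 < Real.sqrt (A / (16 * Real.pi)) by positivity) hm
  refine ⟨ChargedAF.E3, inferInstance, inferInstance, inferInstance, inferInstance, inferInstance,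
    inferInstance, P.metric, P.electricField Q, ChargedAF.standardEnd,
    ⟨P.isAsymptoticallyFlat, P.fieldDecays Q⟩, P.chargedDEC hPQ, ?_, P.hasTotalCharge Q,
    Metric.sphere 0 ρ, P.isOutermostMinimalSurface_sphere hρ hc hc', ?_,
    ChargedAF.nonempty_homeomorph_sphere hρ⟩
  · have h := P.hasADMMass
    rwa [hPm, mul_div_cancel₀ m two_ne_zero] at h
  · have h := ChargedAF.hasArea_sphere P.contDiff_factor P.factor_ne_zero hρ
      (U := P.val (ρ ^ 2)) (fun x hx => by rw [← hx]; rfl)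
    have hA' : 4 * Real.pi * ρ ^ 2 * P.val (ρ ^ 2) ^ 4 = A := by
      rw [hAμ]
      linear_combination (4 * Real.pi *
        (ρ * P.val (ρ ^ 2) ^ 2 + 2 * Real.sqrt (A / (16 * Real.pi)))) * hval
    rwa [hA'] at h
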